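/- **Setting.** Let $d\ge 1$ and let $\Omega\subset\mathbb R^d$ be a bounded open set (e.g. a polyhedral domain) with a finite partition $\mathcal T_h$ into open elements with boundaries of measure zero. Let $\Omega_1,\dots,\Omega_N$ be a nonoverlapping decomposition of $\Omega$ and $\Omega'_i\supseteq\Omega_i$ overlapping subdomains, all of them unions of elements. Call $\Omega_i,\Omega_j$ neighbours if $\bar\Omega_i\cap\bar\Omega_j\ne\emptyset$, and let $\Omega^{(i)}_{k,H}$ be the union of $\Omega_i$ and $k$ layers of neighbouring subdomains around it. Assume that the subdomains have size $H>0$ and are shape regular, i.e. $\operatorname{diam}\Omega_i\le H$ and $\bar\Omega_i$ contains a ball of radius $\sigma H$, where $\sigma>0$, and that $\Omega_i'\subseteq\Omega^{(i)}_{1,H}$. Let $\mathcal S^{(i)}=\{j:\Omega_j'\cap\Omega_i'\neq\emptyset\}$ and $M=\max_i|\mathcal S^{(i)}|$. Let $\theta_i\in L^\infty(\Omega)$ with $0\le\theta_i\le1$, $\sum_i\theta_i=1$ and $\theta_i=0$ outside $\Omega'_i$. Let $V_h\subseteq V(\Omega)\subseteq L^2(\Omega)$ be complex linear spaces with $\dim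 V_h<\infty$ and $\theta_iV_h\subseteq V(\Omega)$. Let $a=\sum_{\tau\in\mathcal T_h}a(\cdot,\cdot)_\tau$ be a Hermitian positive definite sesquilinear form on $V(\Omega)$, where each $a(\cdot,\cdot)_\tau$ is Hermitian positive semidefinite and depends only on the restrictions of its arguments to $\tau$; for a union $\mathcal D$ of elements let $a(\cdot,\cdot)_{\mathcal D}=\sum_{\tau\subset\mathcal D}a(\cdot,\cdot)_\tau$, and let $a_i=a(\cdot,\cdot)_{\Omega_i}$, $|u|_a^2=a(u,u)$. For each $i$ let $s_i$ be a Hermitian positive semidefinite sesquilinear form on $V(\Omega)$ that depends only on restrictions to $\Omega_i$ and is positive definite on $V_h|_{\Omega_i}$; put $\|u\|_{s_i}^2=s_i(u,u)$. Let $I_h:V(\Omega)\to V_h$ be a linear interpolation operator, i.e. $I_hu=u$ for $u\in V_h$, and $I_hu=0$ on each element $\tau$ on which $u=0$. Let $\Lambda>1$, and for each $i$ let $\{\phi^{(i)}_j\}_j$ be an $s_i$-orthonormal basis of $V_h|_{\Omega_i}$ of solutions of the eigenproblem $s_i(\phi_j^{(i)},w)=\lambda_j^{(i)}a_i(\phi_j^{(i)},w)$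 for all $w\in V_h|_{\Omega_i}$, with $\lambda_j^{(i)}\in(0,\infty]$, where $\lambda_j^{(i)}=\infty$ means $a_i(\phi_j^{(i)},\cdot)=0$. Let $V_{aux}^{(i)}$ be the span of the $\phi^{(i)}_j$ with $\lambda^{(i)}_j\ge\Lambda$, and $\pi_i:V_h\to V_{aux}^{(i)}$ the $s_i$-orthogonal projection. Let $\tilde V=\{v\in V_h: s_i(v,w)=0\ \ \forall w\in V^{(i)}_{aux},\ \forall i\}$, let $V_0$ be the $a$-orthogonal complement of $\tilde V$ in $V_h$, and $b(u,v)=a(u,v)+\sum_l s_l(\pi_lu,\pi_lv)$. For $k\in\mathbb N$ let $V^{(i)}_{k,H}$ be the space of functions in $V_h$ supported in $\Omega^{(i)}_{k,H}$, and for each $\phi_j^{(i)}$ with $\lambda_j^{(i)}\ge\Lambda$ let $\bar\psi^{(i)}_{j,k}\in V^{(i)}_{k,H}$ solve $b(\bar\psi^{(i)}_{j,k},v)=s_i(\phi^{(i)}_j,\pi_iv)$ for all $v\in V^{(i)}_{k,H}$. Let $V_0^{k,\bar\psi}$ be the span of all the $\bar\psi^{(i)}_{j,k}$. With the $L^2(\Omega)$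 inner product $(\cdot,\cdot)$ define $A_h$ on $V_h$ by $(A_hu,v)=a(u,v)$, $A_j$ on $V_h(\Omega'_j)=\{u\in V_h:\operatorname{supp}u\subseteq\Omega_j'\}$ by $(A_ju,v)=a(u,v)_{\Omega_j'}$, and $A_0^{k,\bar\psi}$ on $V_0^{k,\bar\psi}$ by $(A_0^{k,\bar\psi}u,v)=a(u,v)$. Let $\Pi_j$, $\Pi_0^{k,\bar\psi}$ be the inclusions of $V_h(\Omega_j')$, $V_0^{k,\bar\psi}$ into $V_h$. The economical preconditioner is $$B^{-1}_{k,\bar\psi}=\sum_{j=1}^N\Pi_jA_j^{-1}\Pi_j^*+\Pi_0^{k,\bar\psi}(A_0^{k,\bar\psi})^{-1}(\Pi_0^{k,\bar\psi})^*.$$ **Assumptions.** There are positive constants $\tilde C,C_{I_a},C_{I_s},c_P,C_p$ with: 1. for all $u\in V_h$, all $i$ and all $j\in\mathcal S^{(i)}$: $a_i(\theta_ju,\theta_ju)\le\tilde C\,(a_i(u,u)+s_i(u,u))$; and $\|\eta u\|_{s_i}\le\|\eta\|_{L^\infty(\Omega_i)}\|u\|_{s_i}$ for all real $\eta\in L^\infty(\Omega)$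 and $u\in V_h$ with $\eta u\in V(\Omega)$; 2. for all $u\in V(\Omega)$: $a(I_hu,I_hu)_\tau\le C_{I_a}a(u,u)_\tau$ for all $\tau\in\mathcal T_h$, and $\sum_l\|I_hu\|_{s_l}^2\le C_{I_s}\sum_l\|u\|_{s_l}^2$; 3. $\sum_l\|\pi_lu_0\|_{s_l}^2\le c_PC_p|u_0|_a^2$ for all $u_0\in V_0$. **Theorem.** Let $C_I=\max\{C_{I_a},C_{I_s}\}$ and $$E=1+\frac{1}{(\tfrac32\tilde CM^2+2)\,C_I\,(1+\Lambda)},\qquad C_2=\tilde C_4\Big(\Lambda+\tilde C_3\Lambda^2(2k+1)^dE^{1-k/2}(1+C_p)\Big),$$ where $\tilde C_4=6+4C_I\tilde CM$, $\tilde C_3=2\tilde C_1\tilde C_2$, $\tilde C_1=3(\tilde C+1)C_IM^2$ and $\tilde C_2=3\tilde CM^2C_I$. Then $E>1$, and for every $k\ge2$ all eigenvalues of $B^{-1}_{k,\bar\psi}A_h$ are real and positive and its condition number (largest eigenvalue divided by smallest) satisfies $$\kappa(B^{-1}_{k,\bar\psi}A_h)\le K\cdot 2MC_2,$$ with a constant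 $K>0$ that depends only on $d$, $\sigma$ and $c_P$. -/

import Mathlib

open MeasureTheory
open scoped ENNReal

noncomputable section

namespace TLOS

/-! ### Function spaces and sesquilinear forms -/

abbrev Pt (d : ℕ) : Type := EuclideanSpace ℝ (Fin d)

/-- The complex space `L²(Ω)`. -/
abbrev L2 {d : ℕ} (Ω : Set (Pt d)) : Type := Lp ℂ 2 (volume.restrict Ω)

/-- The real-valued functions in `L^∞(Ω)`; `η • u` is the product of `η : LInf Ω` and
`u : L2 Ω`. -/
abbrev LInf {d : ℕ} (Ω : Set (Pt d)) : Type := Lp ℝ ∞ (volume.restrict Ω)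

/-- Sesquilinear forms, linear in the first and conjugate linear in the second argument. -/
abbrev SesqForm (E : Type*) [AddCommGroup E] [Module ℂ E] : Type _ := E →ₗ[ℂ] E →ₗ⋆[ℂ] ℂ

/-- Hermitian positive semidefinite forms. -/
structure IsHermitianNonneg {E : Type*} [AddCommGroup E] [Module ℂ E] (c : SesqForm E) :
    Prop where
  hermitian : ∀ u v, c v u = starRingEnd ℂ (c u v)
  nonneg : ∀ u, 0 ≤ (c u u).re

/-- The squared (semi)norm `c(u,u)`, as a real number. -/
def sqNorm {E : Type*} [AddCommGroup E] [Module ℂ E] (c : SesqForm E) (u : E) : ℝ := (c u u).re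

/-- The form `(u, v) ↦ c(f u, f v)`; for an inclusion `f` this is the restriction of `c`. -/
def SesqForm.pullback {E F : Type*} [AddCommGroup E] [Module ℂ E] [AddCommGroup F] [Module ℂ F]
    (c : SesqForm E) (f : F →ₗ[ℂ] E) : SesqForm F :=
  LinearMap.mk₂'ₛₗ (RingHom.id ℂ) (starRingEnd ℂ) (fun u v => c (f u) (f v))
    (by intros; simp) (by intros; simp) (by intros; simp) (by intros; simp)

/-- The operator `A` on a finite-dimensional inner product space with `(A u, v) = c(u, v)`. -/
def formOperator {F : Type*} [NormedAddCommGroup F] [InnerProductSpace ℂ F]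
    [FiniteDimensional ℂ F] (c : SesqForm F) : Module.End ℂ F :=
  ∑ i, (c.flip (stdOrthonormalBasis ℂ F i)).smulRight (stdOrthonormalBasis ℂ F i)

/-- The defining property `(A u, v) = c(u, v)`. The inner product of Mathlib is linear in its
last argument, so that `(x, y)` is written `inner ℂ y x`. -/
theorem inner_formOperator {F : Type*} [NormedAddCommGroup F] [InnerProductSpace ℂ F]
    [FiniteDimensional ℂ F] (c : SesqForm F) (u v : F) :
    inner ℂ v (formOperator c u) = c u v := by
  conv_rhs => rw [← (stdOrthonormalBasis ℂ F).sum_repr v]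
  simp only [formOperator, LinearMap.sum_apply, LinearMap.smulRight_apply, LinearMap.flip_apply,
    inner_sum, inner_smul_right, map_sum, LinearMap.map_smulₛₗ, smul_eq_mul]
  refine Finset.sum_congr rfl fun i _ => ?_
  rw [OrthonormalBasis.repr_apply_apply, inner_conj_symm, mul_comm]

/-- `Π A⁻¹ Π^*` for a subspace `U`, where `Π` is the inclusion of `U`, `Π^*` its adjoint, and `A` is
the operator on `U` with `(A u, v) = c(u, v)`. -/
def subspaceCorrection {F : Type*} [NormedAddCommGroup F] [InnerProductSpace ℂ F]
    [FiniteDimensional ℂ F] (U : Submodule ℂ F) (c : SesqForm F) : Module.End ℂ F :=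
  U.subtype ∘ₗ Ring.inverse (formOperator (c.pullback U.subtype)) ∘ₗ LinearMap.adjoint U.subtype

/-- The condition number of an operator with positive spectrum: the ratio of its extreme
eigenvalues. -/
def condNumber {F : Type*} [AddCommGroup F] [Module ℂ F] (T : Module.End ℂ F) : ℝ :=
  sSup {r : ℝ | ∃ z : ℂ, T.HasEigenvalue z ∧ r = ‖z‖} /
    sInf {r : ℝ | ∃ z : ℂ, T.HasEigenvalue z ∧ r = ‖z‖}

/-! ### Mesh, subdomains, overlapping subdomains, patches -/

/-- A finite partition of `Ω` into open elements. -/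
structure Mesh {d : ℕ} (Ω : Set (Pt d)) where
  card : ℕ
  elem : Fin card → Set (Pt d)
  isOpen_elem : ∀ t, IsOpen (elem t)
  nonempty_elem : ∀ t, (elem t).Nonempty
  elem_subset : ∀ t, elem t ⊆ Ω
  disjoint_elem : ∀ t t', t ≠ t' → Disjoint (elem t) (elem t')
  volume_frontier : ∀ t, volume (frontier (elem t)) = 0
  cover : ⋃ t, closure (elem t) = closure Ω

namespace Mesh

variable {d : ℕ} {Ω : Set (Pt d)} (T : Mesh Ω)

/-- The closed region made up of a set of elements. -/
def region (S : Finset (Fin T.card)) : Set (Pt d) := ⋃ t ∈ S, closure (T.elem t)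

/-- `u = 0` almost everywhere on the element `t`. -/
def VanishesOn (t : Fin T.card) (u : L2 Ω) : Prop :=
  ∀ᵐ x ∂(volume.restrict (T.elem t)), u x = 0

theorem ae_elem_of_ae {t : Fin T.card} {p : Pt d → Prop}
    (h : ∀ᵐ x ∂(volume.restrict Ω), p x) : ∀ᵐ x ∂(volume.restrict (T.elem t)), p x :=
  ae_mono (Measure.restrict_mono (T.elem_subset t) le_rfl) h

/-- The functions supported in the region made up of the elements in `S`. -/
def supportedIn (S : Finset (Fin T.card)) : Submodule ℂ (L2 Ω) where
  carrier := {u | ∀ t, t ∉ S → T.VanishesOn t u}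
  add_mem' := by
    intro u v hu hv t ht
    filter_upwards [hu t ht, hv t ht, T.ae_elem_of_ae (Lp.coeFn_add u v)] with x h1 h2 h3
    rw [h3, Pi.add_apply, h1, h2, add_zero]
  zero_mem' := by
    intro t _
    filter_upwards [T.ae_elem_of_ae (Lp.coeFn_zero ℂ 2 (volume.restrict Ω))] with x h
    rw [h, Pi.zero_apply]
  smul_mem' := by
    intro c u hu t ht
    filter_upwards [hu t ht, T.ae_elem_of_ae (Lp.coeFn_smul c u)] with x h1 h2
    rw [h2, Pi.smul_apply, h1, smul_zero]

end Mesh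

/-- A nonoverlapping decomposition `Ω_1, …, Ω_N` together with overlapping subdomains
`Ω'_i ⊇ Ω_i`. All of these are unions of elements and are given by their sets of elements. -/
structure Decomposition {d : ℕ} {Ω : Set (Pt d)} (T : Mesh Ω) (N : ℕ) where
  sub : Fin N → Finset (Fin T.card)
  ext : Fin N → Finset (Fin T.card)
  sub_nonempty : ∀ i, (sub i).Nonempty
  sub_disjoint : ∀ i j, i ≠ j → Disjoint (sub i) (sub j)
  sub_cover : ∀ t, ∃ i, t ∈ sub i
  sub_subset_ext : ∀ i, sub i ⊆ ext i

namespace Decomposition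

variable {d N : ℕ} {Ω : Set (Pt d)} {T : Mesh Ω} (D : Decomposition T N)

/-- `Ω_i` and `Ω_j` are neighbours: their closures meet. -/
def Neighbour (i j : Fin N) : Prop :=
  (T.region (D.sub i) ∩ T.region (D.sub j)).Nonempty

open Classical in
/-- The indices of the subdomains in the patch `Ω^{(i)}_{k,H}`: the subdomain `Ω_i` and `k`
layers of neighbouring subdomains around it. -/
def patch (i : Fin N) : ℕ → Finset (Fin N)
  | 0 => {i}
  | k + 1 => Finset.univ.filter fun j => ∃ m ∈ patch i k, D.Neighbour m j

/-- The elements of the patch `Ω^{(i)}_{k,H}`. -/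
def patchElems (i : Fin N) (k : ℕ) : Finset (Fin T.card) := (D.patch i k).biUnion D.sub

/-- `S^{(i)}`, the set of all `j` such that `Ω'_j` meets `Ω'_i`. -/
def overlapSet (i : Fin N) : Finset (Fin N) :=
  Finset.univ.filter fun j => (D.ext j ∩ D.ext i).Nonempty

/-- `M`, the largest cardinality of the sets `S^{(i)}`. -/
def M : ℕ := Finset.univ.sup fun i => (D.overlapSet i).card

/-- The subdomains have size `H` and are shape regular, and `Ω'_i` does not reach beyond
the subdomains that are neighbours of `Ω_i`. -/
structure IsRegular (σ H : ℝ) : Prop where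
  dist_le : ∀ i, ∀ x ∈ T.region (D.sub i), ∀ y ∈ T.region (D.sub i), dist x y ≤ H
  ball_subset : ∀ i, ∃ x, Metric.ball x (σ * H) ⊆ T.region (D.sub i)
  ext_subset : ∀ i, D.ext i ⊆ D.patchElems i 1

end Decomposition

/-- A partition of unity subordinate to the overlapping subdomains. -/
structure PartitionUnity {d N : ℕ} {Ω : Set (Pt d)} {T : Mesh Ω} (D : Decomposition T N) where
  θ : Fin N → LInf Ω
  mem_Icc : ∀ i, ∀ᵐ x ∂(volume.restrict Ω), 0 ≤ θ i x ∧ θ i x ≤ 1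
  sum_eq_one : ∀ᵐ x ∂(volume.restrict Ω), ∑ i, θ i x = 1
  support : ∀ i t, t ∉ D.ext i → ∀ᵐ x ∂(volume.restrict (T.elem t)), θ i x = 0

/-! ### The discrete problem -/

/-- The spaces `V_h ⊆ V(Ω) ⊆ L²(Ω)` and the forms `a` and `s_i`. The form `a` is the sum of its
restrictions `aElem t` to the elements of the mesh; the restriction to an element, and the form
`s_i`, depend only on the values of their arguments on this element, and on `Ω_i`,
respectively. -/
structure Discretization {d N : ℕ} {Ω : Set (Pt d)} {T : Mesh Ω} (D : Decomposition T N)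
    (P : PartitionUnity D) where
  V : Submodule ℂ (L2 Ω)
  Vh : Submodule ℂ (L2 Ω)
  Vh_le : Vh ≤ V
  finiteDimensional : FiniteDimensional ℂ Vh
  mul_mem : ∀ (i : Fin N) (u : Vh), P.θ i • (u : L2 Ω) ∈ V
  aElem : Fin T.card → SesqForm V
  aElem_hermitian : ∀ t, IsHermitianNonneg (aElem t)
  aElem_local : ∀ t (u v : V), T.VanishesOn t (u : L2 Ω) → aElem t u v = 0
  a_posDef : ∀ u : V, u ≠ 0 → 0 < ∑ t, sqNorm (aElem t) u
  s : Fin N → SesqForm V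
  s_hermitian : ∀ i, IsHermitianNonneg (s i)
  s_local : ∀ i (u v : V), (∀ t ∈ D.sub i, T.VanishesOn t (u : L2 Ω)) → s i u v = 0
  s_posDef : ∀ i (u : Vh), (¬ ∀ t ∈ D.sub i, T.VanishesOn t (u : L2 Ω)) →
    0 < sqNorm (s i) (Submodule.inclusion Vh_le u)

attribute [instance] Discretization.finiteDimensional

namespace Discretization

variable {d N : ℕ} {Ω : Set (Pt d)} {T : Mesh Ω} {D : Decomposition T N} {P : PartitionUnity D}
  (X : Discretization D P)

/-- The inclusion of `V_h` into `V(Ω)`. -/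
def ι : X.Vh →ₗ[ℂ] X.V := Submodule.inclusion X.Vh_le

/-- The product `θ_i u` of `u ∈ V_h`, an element of `V(Ω)`. -/
def mulθ (i : Fin N) (u : X.Vh) : X.V := ⟨P.θ i • (u : L2 Ω), X.mul_mem i u⟩

/-- The restriction of `a(·,·)` to the region made up of the elements in `S`. -/
def aOn (S : Finset (Fin T.card)) : SesqForm X.V := ∑ t ∈ S, X.aElem t

/-- The form `a(·,·)`. -/
def a : SesqForm X.V := X.aOn Finset.univ

/-- The form `a_i(·,·)`, the restriction of `a` to `Ω_i`. -/
def aSub (i : Fin N) : SesqForm X.V := X.aOn (D.sub i)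

/-- The functions in `V_h` that are supported in the region made up of the elements in `S`. -/
def VhOn (S : Finset (Fin T.card)) : Submodule ℂ X.Vh :=
  (T.supportedIn S).comap X.Vh.subtype

/-- Interpolation operators: they reproduce `V_h` and act element by element. -/
structure IsInterpolation (Ih : X.V →ₗ[ℂ] X.Vh) : Prop where
  apply_eq : ∀ u : X.Vh, Ih (X.ι u) = u
  elementwise : ∀ t (u : X.V), T.VanishesOn t (u : L2 Ω) →
    T.VanishesOn t (Ih u : L2 Ω)

/-- The stability of `θ_j u` in the energy, and the bound for multiplication by `L^∞` functions,
with constant `Ct`. -/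
structure CutoffStable (Ct : ℝ) : Prop where
  energy_le : ∀ (u : X.Vh) (i j : Fin N), j ∈ D.overlapSet i →
    sqNorm (X.aSub i) (X.mulθ j u) ≤ Ct * (sqNorm (X.aSub i) (X.ι u) + sqNorm (X.s i) (X.ι u))
  mul_le : ∀ (i : Fin N) (η : LInf Ω) (u : X.Vh) (w : X.V),
    (w : L2 Ω) = η • (u : L2 Ω) →
    √(sqNorm (X.s i) w) ≤
      (eLpNorm η ∞ (volume.restrict (T.region (D.sub i)))).toReal * √(sqNorm (X.s i) (X.ι u))

/-- The stability of the interpolation operator, with constants `CIa` and `CIs`. -/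
structure InterpolationStable (Ih : X.V →ₗ[ℂ] X.Vh) (CIa CIs : ℝ) : Prop where
  a_le : ∀ (u : X.V) t, sqNorm (X.aElem t) (X.ι (Ih u)) ≤ CIa * sqNorm (X.aElem t) u
  s_le : ∀ u : X.V, ∑ l, sqNorm (X.s l) (X.ι (Ih u)) ≤ CIs * ∑ l, sqNorm (X.s l) u

/-- A complete system of eigenfunctions of the local generalized eigenproblem
`s_i(φ_j, w) = λ_j a_i(φ_j, w)` for all `w ∈ V_h|_{Ω_i}`, orthonormal with respect to `s_i`.
A function in `V_h|_{Ω_i}` is given by an element of `V_h` with this restriction. Since `a_i` may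
vanish on some functions, where `λ_j = ∞`, the reciprocal eigenvalues `ev j = 1 / λ_j` are used. -/
structure LocalEigenbasis (i : Fin N) where
  n : ℕ
  φ : Fin n → X.Vh
  ev : Fin n → ℝ
  eigen : ∀ j (w : X.Vh),
    X.aSub i (X.ι (φ j)) (X.ι w) = (ev j : ℂ) * X.s i (X.ι (φ j)) (X.ι w)
  orthonormal : ∀ j j', X.s i (X.ι (φ j)) (X.ι (φ j')) = if j = j' then 1 else 0
  complete : ∀ u : X.Vh, ∃ c : Fin n → ℂ, ∀ t ∈ D.sub i,
    T.VanishesOn t ((u - ∑ j, c j • φ j : X.Vh) : L2 Ω)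

variable {X}

/-- The indices of the eigenfunctions with eigenvalue `λ_j ≥ Λ`; they span `V_aux^{(i)}`. -/
def LocalEigenbasis.selected {i : Fin N} (e : X.LocalEigenbasis i) (Λ : ℝ) : Finset (Fin e.n) :=
  Finset.univ.filter fun j => Λ * e.ev j ≤ 1

/-- The `s_i`-orthogonal projection `π_i` of `V_h` onto `V_aux^{(i)}`. -/
def LocalEigenbasis.proj {i : Fin N} (e : X.LocalEigenbasis i) (Λ : ℝ) (v : X.Vh) : X.Vh :=
  ∑ j ∈ e.selected Λ, X.s i (X.ι v) (X.ι (e.φ j)) • e.φ j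

/-- The defining property of `π_i`, tested with the functions that span `V_aux^{(i)}`. -/
theorem LocalEigenbasis.s_proj {i : Fin N} (e : X.LocalEigenbasis i) (Λ : ℝ) (v : X.Vh)
    {j : Fin e.n} (hj : j ∈ e.selected Λ) :
    X.s i (X.ι (e.proj Λ v)) (X.ι (e.φ j)) = X.s i (X.ι v) (X.ι (e.φ j)) := by
  simp [LocalEigenbasis.proj, e.orthonormal, hj]

variable (X)

/-- The form `b(u,v) = a(u,v) + ∑ s_l(π_l u, π_l v)` on `V_h`. -/
def b (e : ∀ i, X.LocalEigenbasis i) (Λ : ℝ) (u v : X.Vh) : ℂ :=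
  X.a (X.ι u) (X.ι v) +
    ∑ l, X.s l (X.ι ((e l).proj Λ u)) (X.ι ((e l).proj Λ v))

/-- `Ṽ`, the functions in `V_h` that are `s_i`-orthogonal to `V_aux^{(i)}` for all `i`. -/
def tildeV (e : ∀ i, X.LocalEigenbasis i) (Λ : ℝ) : Set X.Vh :=
  {v | ∀ i, ∀ j ∈ (e i).selected Λ, X.s i (X.ι v) (X.ι ((e i).φ j)) = 0}

/-- The coarse space `V_0`, the `a`-orthogonal complement of `Ṽ` in `V_h`. -/
def V0 (e : ∀ i, X.LocalEigenbasis i) (Λ : ℝ) : Set X.Vh :=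
  {u | ∀ v ∈ X.tildeV e Λ, X.a (X.ι u) (X.ι v) = 0}

/-- `∑ ‖π_l u₀‖²_{s_l} ≤ C |u₀|²_a` on the coarse space `V_0`. -/
def PoincareBound (e : ∀ i, X.LocalEigenbasis i) (Λ C : ℝ) : Prop :=
  ∀ u₀ ∈ X.V0 e Λ, ∑ l, sqNorm (X.s l) (X.ι ((e l).proj Λ u₀)) ≤ C * sqNorm X.a (X.ι u₀)

/-- `ψ` is the solution on the patch `Ω^{(i)}_{k,H}` of
`b(ψ, v) = s_i(φ_j, π_i v)` for all `v ∈ V_h` supported in this patch. -/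
def IsPatchSolution (e : ∀ i, X.LocalEigenbasis i) (Λ : ℝ) (k : ℕ) (i : Fin N)
    (j : Fin (e i).n) (ψ : X.Vh) : Prop :=
  ψ ∈ X.VhOn (D.patchElems i k) ∧
    ∀ v ∈ X.VhOn (D.patchElems i k),
      X.b e Λ ψ v = X.s i (X.ι ((e i).φ j)) (X.ι ((e i).proj Λ v))

/-- The economical coarse space, spanned by the patch solutions for the selected eigenfunctions. -/
def coarseSpace (e : ∀ i, X.LocalEigenbasis i) (Λ : ℝ) (k : ℕ) : Submodule ℂ X.Vh :=
  Submodule.span ℂ {ψ | ∃ i, ∃ j ∈ (e i).selected Λ, X.IsPatchSolution e Λ k i j ψ}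

/-- `A_h`, with `(A_h u, v) = a(u, v)` in the inner product of `L²(Ω)`. -/
def Ah : Module.End ℂ X.Vh := formOperator (X.a.pullback X.ι)

/-- The economical preconditioner `B⁻¹_{k,ψ̄}`. -/
def precond (e : ∀ i, X.LocalEigenbasis i) (Λ : ℝ) (k : ℕ) : Module.End ℂ X.Vh :=
  (∑ j, subspaceCorrection (X.VhOn (D.ext j))
      ((X.aOn (D.ext j)).pullback X.ι)) +
    subspaceCorrection (X.coarseSpace e Λ k) (X.a.pullback X.ι)

end Discretization

/-- `E = 1 + (Ĉ (1 + Λ))⁻¹` with `Ĉ = (3/2 C̃ M² + 2) C_I`. -/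
def decayBase (Ct CI M Λ : ℝ) : ℝ := (((3 / 2 * Ct * M ^ 2 + 2) * CI) * (1 + Λ))⁻¹ + 1

/-- `C₀ = C̃₃ Λ² (2k+1)^d E^{1-k/2} (1 + C_p)` with `C̃₃ = 2 C̃₁ C̃₂`,
`C̃₁ = 3 (C̃ + 1) C_I M²` and `C̃₂ = 3 C̃ M² C_I`. -/
def constC0 (d k : ℕ) (Ct CI M Λ Cp : ℝ) : ℝ :=
  2 * (3 * (Ct + 1) * CI * M ^ 2) * (3 * Ct * M ^ 2 * CI) * Λ ^ 2 * (2 * k + 1) ^ d *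
    decayBase Ct CI M Λ ^ (1 - (k : ℝ) / 2) * (1 + Cp)

/-- `C₂ = C̃₄ (Λ + C₀)` with `C̃₄ = 6 + 4 C_I C̃ M`. -/
def constC2 (d k : ℕ) (Ct CI M Λ Cp : ℝ) : ℝ :=
  (6 + 4 * CI * Ct * M) * (Λ + constC0 d k Ct CI M Λ Cp)

end TLOS

end

/-!
The condition number is bounded by the abstract theory of additive Schwarz methods
(`IsSchwarzOperator.condNumber_le`). The operator `B⁻¹ A_h` is a sum of `a`-orthogonal projections
onto the spaces on the overlapping subdomains and the coarse space. Each of the local spaces is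
orthogonal to all but `M` of the others, so that the eigenvalues are at most `M + 1 ≤ 2 M`. They
are at least `1 / S` if every `u` has a decomposition `u = u₀ + ∑ u_j` along these spaces of
energy at most `S a(u,u)`. Here `u₀` is a coarse approximation of `u` and
`u_j = I_h(θ_j (u - u₀))` (`exists_stable_decomposition`).

The coarse approximation starts from `ψ = ∑ ψ_i`, where `b(ψ_i, v) = s_i(π_i u, π_i v)` for all
`v`. Then `b(u - ψ, v) = a(u, v)`, so that the energy `b` of `u - ψ` is at most `a(u,u)`. The
functions `ψ_i` are replaced by their Galerkin approximations on the patches, which lie in the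
coarse space. The Poincaré bound on `V_0`, which extends to `V_h` because `V_h` is the
`a`-orthogonal sum of `V_0` and `Ṽ`, bounds the sum of the energies of the `ψ_i`
(`exists_coarse_approximation`).

The localization errors are controlled by a decay estimate, which only uses that `b` is a sum of
forms on the subdomains, and that `u ↦ I_h(χ u)` is bounded with a constant `κ` for sums `χ` of
functions of the partition of unity, by the values of `u` near the support of `χ`
(`LocalSplitting`). Testing the equation of `ψ_i` with `I_h(χ ψ_i)`, where `χ` is the sum of the
`θ_j` with `j` outside a patch, bounds the energy outside the patch by `√κ` times the energy in
a few layers around its boundary (`LocalSplitting.tail_le_sqrt_mul`). The stability of `I_h` in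
the norms `s_l` is assumed only for the sum over all `l`. For this reason, `χ` is replaced
by the sum over a ring of subdomains, which does not change the test function where it matters,
and a decay step costs four layers. Since the
factor is `√κ` rather than `κ`, the rate is still better than the required one, and it also
compensates the factor `κ` in the estimate of the Galerkin error (`min_div_pow_le`). Finally, the
errors for different `i` are almost orthogonal (`LocalSplitting.sqNorm_sum_error_le`), with a
factor given by the number of subdomains in a patch. This number, as well as `M`, is bounded by
comparing volumes (`Decomposition.IsRegular.card_patch_le`).
-/

noncomputable section

namespace TLOS

/-! ### Hermitian positive semidefinite forms -/

section Forms

variable {E F : Type*} [AddCommGroup E] [Module ℂ E] [AddCommGroup F] [Module ℂ F]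

@[simp]
theorem SesqForm.pullback_apply (c : SesqForm E) (f : F →ₗ[ℂ] E) (u v : F) :
    c.pullback f u v = c (f u) (f v) := rfl

theorem sqNorm_sum_form {ι : Type*} (s : Finset ι) (c : ι → SesqForm E) (u : E) :
    sqNorm (∑ i ∈ s, c i) u = ∑ i ∈ s, sqNorm (c i) u := by
  simp [sqNorm, LinearMap.sum_apply]

theorem sqNorm_add_form (c c' : SesqForm E) (u : E) :
    sqNorm (c + c') u = sqNorm c u + sqNorm c' u := by
  simp [sqNorm]

namespace IsHermitianNonneg

variable {c c' : SesqForm E}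

theorem pullback (hc : IsHermitianNonneg c) (f : F →ₗ[ℂ] E) : IsHermitianNonneg (c.pullback f) :=
  ⟨fun u v => hc.hermitian (f u) (f v), fun u => hc.nonneg (f u)⟩

theorem add (hc : IsHermitianNonneg c) (hc' : IsHermitianNonneg c') :
    IsHermitianNonneg (c + c') :=
  ⟨fun u v => by simp [hc.hermitian u v, hc'.hermitian u v],
    fun u => by simpa using add_nonneg (hc.nonneg u) (hc'.nonneg u)⟩

theorem sum {ι : Type*} (s : Finset ι) {c : ι → SesqForm E}
    (hc : ∀ i ∈ s, IsHermitianNonneg (c i)) : IsHermitianNonneg (∑ i ∈ s, c i) := by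
  classical
  induction s using Finset.induction_on with
  | empty => exact ⟨by simp, by simp⟩
  | insert i s hi ih =>
    rw [Finset.sum_insert hi]
    exact (hc i (by simp)).add (ih fun j hj => hc j (by simp [hj]))

theorem sqNorm_nonneg (hc : IsHermitianNonneg c) (u : E) : 0 ≤ sqNorm c u := hc.nonneg u

theorem re_comm (hc : IsHermitianNonneg c) (u v : E) : (c u v).re = (c v u).re := by
  rw [hc.hermitian v u, Complex.conj_re]

theorem apply_self (hc : IsHermitianNonneg c) (u : E) : c u u = (sqNorm c u : ℂ) := by
  have h := hc.hermitian u u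
  exact (Complex.conj_eq_iff_re.1 h.symm).symm

/-- The form as a semi-inner product in Mathlib's convention, which is conjugate linear in the first
argument. -/
@[reducible]
def toCore (hc : IsHermitianNonneg c) : PreInnerProductSpace.Core ℂ E where
  inner u v := c v u
  conj_inner_symm u v := (hc.hermitian u v).symm
  re_inner_nonneg u := hc.nonneg u
  add_left u v w := by simp
  smul_left u v r := by simp

/-- The Cauchy-Schwarz inequality. -/
theorem norm_apply_le (hc : IsHermitianNonneg c) (u v : E) :
    ‖c u v‖ ≤ √(sqNorm c u) * √(sqNorm c v) := by
  let := hc.toCore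
  have h := InnerProductSpace.Core.norm_inner_le_norm (𝕜 := ℂ) v u
  rw [mul_comm]
  exact h

theorem abs_re_apply_le (hc : IsHermitianNonneg c) (u v : E) :
    |(c u v).re| ≤ √(sqNorm c u) * √(sqNorm c v) :=
  (Complex.abs_re_le_norm _).trans (hc.norm_apply_le u v)

theorem re_apply_le (hc : IsHermitianNonneg c) (u v : E) :
    (c u v).re ≤ √(sqNorm c u) * √(sqNorm c v) :=
  (le_abs_self _).trans (hc.abs_re_apply_le u v)

theorem two_re_apply_le (hc : IsHermitianNonneg c) (u v : E) :
    2 * (c u v).re ≤ sqNorm c u + sqNorm c v := by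
  have h := hc.re_apply_le u v
  have h1 := Real.sq_sqrt (hc.sqNorm_nonneg u)
  have h2 := Real.sq_sqrt (hc.sqNorm_nonneg v)
  nlinarith [sq_nonneg (√(sqNorm c u) - √(sqNorm c v))]

theorem sqNorm_add (hc : IsHermitianNonneg c) (u v : E) :
    sqNorm c (u + v) = sqNorm c u + 2 * (c u v).re + sqNorm c v := by
  have h := hc.re_comm u v
  simp only [sqNorm, map_add, LinearMap.add_apply, Complex.add_re]
  linarith

theorem sqNorm_sub (hc : IsHermitianNonneg c) (u v : E) :
    sqNorm c (u - v) = sqNorm c u - 2 * (c u v).re + sqNorm c v := by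
  have h := hc.re_comm u v
  simp only [sqNorm, map_sub, LinearMap.sub_apply, Complex.sub_re]
  linarith

theorem sqNorm_add_le (hc : IsHermitianNonneg c) (u v : E) :
    sqNorm c (u + v) ≤ 2 * sqNorm c u + 2 * sqNorm c v := by
  have h1 := hc.sqNorm_add u v
  have h2 := hc.two_re_apply_le u v
  linarith

theorem sqNorm_sub_le (hc : IsHermitianNonneg c) (u v : E) :
    sqNorm c (u - v) ≤ 2 * sqNorm c u + 2 * sqNorm c v := by
  have h1 := hc.sqNorm_sub u v
  have h2 := hc.sqNorm_nonneg (u + v)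
  have h3 := hc.sqNorm_add u v
  linarith

theorem sqNorm_sum_eq {ι : Type*} (s : Finset ι) (f : ι → E) :
    sqNorm c (∑ i ∈ s, f i) = ∑ i ∈ s, ∑ j ∈ s, (c (f i) (f j)).re := by
  simp only [sqNorm, map_sum, LinearMap.sum_apply, Complex.re_sum]
  exact Finset.sum_comm

theorem sqNorm_sum_le (hc : IsHermitianNonneg c) {ι : Type*} (s : Finset ι) (f : ι → E) :
    sqNorm c (∑ i ∈ s, f i) ≤ s.card * ∑ i ∈ s, sqNorm c (f i) := by
  rw [sqNorm_sum_eq]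
  calc ∑ i ∈ s, ∑ j ∈ s, (c (f i) (f j)).re
      ≤ ∑ i ∈ s, ∑ j ∈ s, (sqNorm c (f i) + sqNorm c (f j)) / 2 :=
        Finset.sum_le_sum fun i _ => Finset.sum_le_sum fun j _ => by
          linarith [hc.two_re_apply_le (f i) (f j)]
    _ = s.card * ∑ i ∈ s, sqNorm c (f i) := by
        simp only [add_div, Finset.sum_add_distrib, Finset.sum_const, nsmul_eq_mul,
          ← Finset.mul_sum, ← Finset.sum_div]
        ring

/-- If `c(u, ·) = 0`, then adding `u` does not change the seminorm. -/
theorem sqNorm_congr_of_null (hc : IsHermitianNonneg c) {u v : E}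
    (h : ∀ w, c (u - v) w = 0) : sqNorm c u = sqNorm c v := by
  have h1 : sqNorm c (u - v) = 0 := by rw [sqNorm, h, Complex.zero_re]
  have h2 := hc.sqNorm_add (u - v) v
  rw [sub_add_cancel, h1, h] at h2
  simpa using h2

end IsHermitianNonneg

end Forms

section Correction

variable {F : Type*} [NormedAddCommGroup F] [InnerProductSpace ℂ F] [FiniteDimensional ℂ F]

/-- The operator of a positive definite form is invertible, so that `Ring.inverse` does not take its
junk value. -/
theorem isUnit_formOperator {c : SesqForm F} (hc : ∀ u, u ≠ 0 → 0 < sqNorm c u) :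
    IsUnit (formOperator c) := by
  rw [LinearMap.isUnit_iff_ker_eq_bot, LinearMap.ker_eq_bot']
  intro u hu
  by_contra hne
  have h := inner_formOperator c u u
  rw [hu, inner_zero_right] at h
  have := hc u hne
  simp [sqNorm, ← h] at this

theorem subspaceCorrection_mem (U : Submodule ℂ F) (c : SesqForm F) (x : F) :
    subspaceCorrection U c x ∈ U := by
  simp [subspaceCorrection]

/-- The correction in `U` of the operator of a form `c'` is the Galerkin solution in `U` of the
equation `c(p, ·) = c'(u, ·)`. -/
theorem subspaceCorrection_formOperator (U : Submodule ℂ F) (c c' : SesqForm F)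
    (hc : ∀ u ∈ U, u ≠ 0 → 0 < sqNorm c u) (u : F) {v : F} (hv : v ∈ U) :
    c (subspaceCorrection U c (formOperator c' u)) v = c' u v := by
  have hunit : IsUnit (formOperator (c.pullback U.subtype)) :=
    isUnit_formOperator fun w hw => hc w w.2 (by simpa using hw)
  set x := LinearMap.adjoint U.subtype (formOperator c' u) with hx
  set p := Ring.inverse (formOperator (c.pullback U.subtype)) x with hp
  have h1 : formOperator (c.pullback U.subtype) p = x := by
    rw [hp, ← Module.End.mul_apply, Ring.mul_inverse_cancel _ hunit, Module.End.one_apply]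
  have h2 := inner_formOperator (c.pullback U.subtype) p ⟨v, hv⟩
  rw [h1, hx, LinearMap.adjoint_inner_right, Submodule.subtype_apply, inner_formOperator] at h2
  exact h2.symm

/-- Solvability of variational problems on a subspace. -/
theorem exists_galerkin (U : Submodule ℂ F) (c c' : SesqForm F)
    (hc : ∀ u ∈ U, u ≠ 0 → 0 < sqNorm c u) (u : F) :
    ∃ p ∈ U, ∀ v ∈ U, c p v = c' u v :=
  ⟨_, subspaceCorrection_mem U c (formOperator c' u),
    fun _ hv => subspaceCorrection_formOperator U c c' hc u hv⟩

end Correction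

/-! ### Additive Schwarz operators -/

section Schwarz

variable {E : Type*} [AddCommGroup E] [Module ℂ E] {ι : Type*} [Fintype ι]

/-- A sum `T = P₀ + ∑ P_j` of projections, orthogonal with respect to the form `c`, onto subspaces
`U₀` and `U_j`. -/
structure IsSchwarzOperator (c : SesqForm E) (U₀ : Submodule ℂ E) (U : ι → Submodule ℂ E)
    (P₀ : E → E) (P : ι → E → E) (T : Module.End ℂ E) : Prop where
  apply_eq : ∀ u, T u = ∑ j, P j u + P₀ u
  mem₀ : ∀ u, P₀ u ∈ U₀
  mem : ∀ j u, P j u ∈ U j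
  proj₀ : ∀ u, ∀ v ∈ U₀, c (P₀ u) v = c u v
  proj : ∀ j u, ∀ v ∈ U j, c (P j u) v = c u v

namespace IsSchwarzOperator

variable {c : SesqForm E} {U₀ : Submodule ℂ E} {U : ι → Submodule ℂ E}
    {P₀ : E → E} {P : ι → E → E} {T : Module.End ℂ E}

/-- An orthogonal projection `p` of `u` satisfies `c(p, u) = c(p, p)`. -/
theorem apply_proj (hc : IsHermitianNonneg c) {W : Submodule ℂ E} {u p : E} (hp : p ∈ W)
    (h : ∀ v ∈ W, c p v = c u v) : c p u = (sqNorm c p : ℂ) := by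
  rw [hc.hermitian u p, ← h p hp, hc.apply_self, Complex.conj_ofReal]

theorem form_apply (hT : IsSchwarzOperator c U₀ U P₀ P T) (hc : IsHermitianNonneg c) (u : E) :
    c (T u) u = ((∑ j, sqNorm c (P j u) + sqNorm c (P₀ u) : ℝ) : ℂ) := by
  rw [hT.apply_eq, map_add, map_sum, LinearMap.add_apply, LinearMap.sum_apply,
    apply_proj hc (hT.mem₀ u) (hT.proj₀ u)]
  simp only [apply_proj hc (hT.mem _ u) (hT.proj _ u)]
  push_cast
  rfl

theorem sqNorm_proj_le (hc : IsHermitianNonneg c) {W : Submodule ℂ E} {u p : E} (hp : p ∈ W)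
    (h : ∀ v ∈ W, c p v = c u v) : sqNorm c p ≤ sqNorm c u := by
  have h1 : (c p u).re = sqNorm c p := by rw [apply_proj hc hp h, Complex.ofReal_re]
  have h2 := hc.two_re_apply_le p u
  linarith

/-- If every `U_i` is orthogonal to all but `m` of the `U_j`, then the energies of the local
projections add up to at most `m` times the energy. -/
theorem sum_sqNorm_proj_le (hT : IsSchwarzOperator c U₀ U P₀ P T) (hc : IsHermitianNonneg c)
    {m : ℕ} (nb : ι → Finset ι) (hsymm : ∀ i j, j ∈ nb i → i ∈ nb j)
    (hcard : ∀ i, (nb i).card ≤ m)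
    (horth : ∀ i j, j ∉ nb i → ∀ u ∈ U i, ∀ v ∈ U j, c u v = 0) (u : E) :
    ∑ j, sqNorm c (P j u) ≤ m * sqNorm c u := by
  classical
  set S := ∑ j, sqNorm c (P j u) with hS
  have hS0 : 0 ≤ S := Finset.sum_nonneg fun j _ => hc.sqNorm_nonneg _
  have h1 : (c (∑ j, P j u) u).re = S := by
    rw [map_sum, LinearMap.sum_apply, Complex.re_sum]
    refine Finset.sum_congr rfl fun j _ => ?_
    rw [apply_proj hc (hT.mem j u) (hT.proj j u), Complex.ofReal_re]
  have hle : ∀ i, ((nb i).card : ℝ) * sqNorm c (P i u) ≤ m * sqNorm c (P i u) := fun i =>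
    mul_le_mul_of_nonneg_right (by exact_mod_cast hcard i) (hc.sqNorm_nonneg _)
  have h2 : sqNorm c (∑ j, P j u) ≤ m * S := by
    rw [IsHermitianNonneg.sqNorm_sum_eq]
    have e1 : ∀ i, ∑ j, (c (P i u) (P j u)).re
        ≤ ∑ j, if j ∈ nb i then (sqNorm c (P i u) / 2 + sqNorm c (P j u) / 2) else 0 := by
      intro i
      refine Finset.sum_le_sum fun j _ => ?_
      split_ifs with hj
      · linarith [hc.two_re_apply_le (P i u) (P j u)]
      · rw [horth i j hj _ (hT.mem i u) _ (hT.mem j u), Complex.zero_re]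
    refine (Finset.sum_le_sum fun i _ => e1 i).trans ?_
    have e2 : ∀ i j, (if j ∈ nb i then (sqNorm c (P i u) / 2 + sqNorm c (P j u) / 2) else 0)
        = (if j ∈ nb i then sqNorm c (P i u) / 2 else 0)
          + (if i ∈ nb j then sqNorm c (P j u) / 2 else 0) := by
      intro i j
      by_cases h : j ∈ nb i
      · simp [h, hsymm i j h]
      · have h' : i ∉ nb j := fun h' => h (hsymm j i h')
        simp [h, h']
    simp only [e2, Finset.sum_add_distrib]
    rw [Finset.sum_comm (f := fun i j => if i ∈ nb j then sqNorm c (P j u) / 2 else 0)]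
    have e3 : ∑ i, ∑ j, (if j ∈ nb i then sqNorm c (P i u) / 2 else 0) ≤ m * S / 2 := by
      rw [hS, Finset.mul_sum, Finset.sum_div]
      refine Finset.sum_le_sum fun i _ => ?_
      rw [Finset.sum_ite_mem, Finset.univ_inter, Finset.sum_const, nsmul_eq_mul]
      linarith [hle i]
    linarith
  rcases hS0.eq_or_lt with h0 | hpos
  · rw [← h0]; exact mul_nonneg (Nat.cast_nonneg m) (hc.sqNorm_nonneg u)
  have h3 : S ^ 2 ≤ (m * S) * sqNorm c u := by
    have h4 := hc.re_apply_le (∑ j, P j u) u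
    rw [h1] at h4
    calc S ^ 2 ≤ (√(sqNorm c (∑ j, P j u)) * √(sqNorm c u)) ^ 2 :=
          pow_le_pow_left₀ hS0 h4 2
      _ = sqNorm c (∑ j, P j u) * sqNorm c u := by
          rw [mul_pow, Real.sq_sqrt (hc.sqNorm_nonneg _), Real.sq_sqrt (hc.sqNorm_nonneg _)]
      _ ≤ _ := mul_le_mul_of_nonneg_right h2 (hc.sqNorm_nonneg u)
  nlinarith

/-- A stable decomposition of `u` bounds the energy of `u` by the energies of its projections. -/
theorem sqNorm_le_of_decomposition (hT : IsSchwarzOperator c U₀ U P₀ P T)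
    (hc : IsHermitianNonneg c) {S : ℝ} (hS0 : 0 < S) {u u₀ : E} {w : ι → E} (h₀ : u₀ ∈ U₀)
    (hw : ∀ j, w j ∈ U j) (hu : u = ∑ j, w j + u₀)
    (hS : ∑ j, sqNorm c (w j) + sqNorm c u₀ ≤ S * sqNorm c u) :
    sqNorm c u ≤ S * (∑ j, sqNorm c (P j u) + sqNorm c (P₀ u)) := by
  have h1 : sqNorm c u = ∑ j, (c (P j u) (w j)).re + (c (P₀ u) u₀).re := by
    have : c u u = ∑ j, c (P j u) (w j) + c (P₀ u) u₀ := by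
      rw [hT.proj₀ u _ h₀]
      simp only [hT.proj _ u _ (hw _)]
      rw [← map_sum, ← map_add, ← hu]
    rw [sqNorm, this, Complex.add_re, Complex.re_sum]
  -- the Cauchy-Schwarz inequality, weighted by `S`
  have key : ∀ x y : E, 2 * S * (c x y).re ≤ S ^ 2 * sqNorm c x + sqNorm c y := by
    intro x y
    have := hc.two_re_apply_le ((S : ℂ) • x) y
    have e : sqNorm c ((S : ℂ) • x) = S ^ 2 * sqNorm c x := by
      simp only [sqNorm, map_smul, LinearMap.smul_apply, LinearMap.map_smulₛₗ, smul_eq_mul,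
        Complex.conj_ofReal, Complex.re_ofReal_mul]
      ring
    rw [e] at this
    simp only [map_smul, LinearMap.smul_apply, smul_eq_mul, Complex.re_ofReal_mul] at this
    linarith
  have h2 : 2 * S * sqNorm c u ≤ S ^ 2 * (∑ j, sqNorm c (P j u) + sqNorm c (P₀ u))
      + (∑ j, sqNorm c (w j) + sqNorm c u₀) := by
    rw [h1, mul_add, mul_add, Finset.mul_sum, Finset.mul_sum]
    have e1 := Finset.sum_le_sum fun j (_ : j ∈ Finset.univ) => key (P j u) (w j)
    rw [Finset.sum_add_distrib] at e1
    linarith [key (P₀ u) u₀]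
  nlinarith

/-- The abstract Schwarz theory: a bound for the overlaps and a stable decomposition bound the
condition number. -/
theorem condNumber_le [FiniteDimensional ℂ E] [Nontrivial E]
    (hT : IsSchwarzOperator c U₀ U P₀ P T) (hc : IsHermitianNonneg c)
    (hpos : ∀ u, u ≠ 0 → 0 < sqNorm c u)
    {m : ℕ} (hm : 1 ≤ m) (nb : ι → Finset ι) (hsymm : ∀ i j, j ∈ nb i → i ∈ nb j)
    (hcard : ∀ i, (nb i).card ≤ m)
    (horth : ∀ i j, j ∉ nb i → ∀ u ∈ U i, ∀ v ∈ U j, c u v = 0)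
    {S : ℝ} (hS0 : 0 < S)
    (hdec : ∀ u, ∃ u₀ ∈ U₀, ∃ w : ι → E, (∀ j, w j ∈ U j) ∧ u = ∑ j, w j + u₀ ∧
      ∑ j, sqNorm c (w j) + sqNorm c u₀ ≤ S * sqNorm c u) :
    (∀ z : ℂ, T.HasEigenvalue z → 0 < z.re ∧ z.im = 0) ∧ condNumber T ≤ 2 * m * S := by
  have key : ∀ z : ℂ, T.HasEigenvalue z → ∃ r : ℝ, z = r ∧ 1 / S ≤ r ∧ r ≤ 2 * m := by
    intro z hz
    obtain ⟨u, hu⟩ := hz.exists_hasEigenvector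
    have hne : u ≠ 0 := hu.2
    have hup := hpos u hne
    set A := ∑ j, sqNorm c (P j u) + sqNorm c (P₀ u) with hA
    have h1 := hT.form_apply hc u
    rw [hu.apply_eq_smul, map_smul, LinearMap.smul_apply, smul_eq_mul, hc.apply_self, ← hA] at h1
    have hz' : z = ((A / sqNorm c u : ℝ) : ℂ) := by
      rw [Complex.ofReal_div, eq_div_iff (by exact_mod_cast hup.ne'), h1]
    refine ⟨_, hz', ?_, ?_⟩
    · obtain ⟨u₀, h₀, w, hw, hsum, hle⟩ := hdec u
      have := hT.sqNorm_le_of_decomposition hc hS0 h₀ hw hsum hle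
      rw [div_le_div_iff₀ hS0 hup]
      linarith
    · rw [div_le_iff₀ hup]
      have h2 := hT.sum_sqNorm_proj_le hc nb hsymm hcard horth u
      have h3 := sqNorm_proj_le hc (hT.mem₀ u) (hT.proj₀ u)
      have h4 : (1 : ℝ) ≤ m := by exact_mod_cast hm
      nlinarith
  have hinv : 0 < 1 / S := by positivity
  refine ⟨fun z hz => ?_, ?_⟩
  · obtain ⟨r, rfl, h1, -⟩ := key z hz
    exact ⟨by simpa using hinv.trans_le h1, Complex.ofReal_im r⟩
  · obtain ⟨z, hz⟩ := Module.End.exists_eigenvalue T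
    have hne : {r : ℝ | ∃ z : ℂ, T.HasEigenvalue z ∧ r = ‖z‖}.Nonempty := ⟨‖z‖, z, hz, rfl⟩
    have hbd : ∀ r ∈ {r : ℝ | ∃ z : ℂ, T.HasEigenvalue z ∧ r = ‖z‖}, 1 / S ≤ r ∧ r ≤ 2 * m := by
      rintro _ ⟨z, hz, rfl⟩
      obtain ⟨r, rfl, h1, h2⟩ := key z hz
      rw [Complex.norm_real, Real.norm_of_nonneg (hinv.le.trans h1)]
      exact ⟨h1, h2⟩
    have hsup := csSup_le hne fun r hr => (hbd r hr).2
    have hinf := le_csInf hne fun r hr => (hbd r hr).1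
    rw [condNumber, div_le_iff₀ (hinv.trans_le hinf)]
    refine hsup.trans ?_
    calc (2 * m : ℝ) = 2 * m * S * (1 / S) := by field_simp
      _ ≤ _ := mul_le_mul_of_nonneg_left hinf (by positivity)

end IsSchwarzOperator

end Schwarz

/-! ### Patches of subdomains -/

namespace Decomposition

variable {d N : ℕ} {Ω : Set (Pt d)} {T : Mesh Ω} (D : Decomposition T N)

theorem region_sub_nonempty (i : Fin N) : (T.region (D.sub i)).Nonempty := by
  obtain ⟨t, ht⟩ := D.sub_nonempty i
  obtain ⟨x, hx⟩ := T.nonempty_elem t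
  exact ⟨x, Set.mem_iUnion₂.2 ⟨t, ht, subset_closure hx⟩⟩

theorem neighbour_self (i : Fin N) : D.Neighbour i i := by
  simpa [Neighbour] using D.region_sub_nonempty i

variable {D}

theorem Neighbour.symm {i j : Fin N} (h : D.Neighbour i j) : D.Neighbour j i := by
  rwa [Neighbour, Set.inter_comm]

theorem mem_patch_zero {i l : Fin N} : l ∈ D.patch i 0 ↔ l = i := by
  simp [patch]

theorem mem_patch_succ {i l : Fin N} {k : ℕ} :
    l ∈ D.patch i (k + 1) ↔ ∃ m ∈ D.patch i k, D.Neighbour m l := by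
  simp [patch]

theorem mem_patch_one {i l : Fin N} : l ∈ D.patch i 1 ↔ D.Neighbour i l := by
  rw [mem_patch_succ]
  simp [mem_patch_zero]

theorem Neighbour.mem_patch {i l m : Fin N} {k : ℕ} (h : D.Neighbour m l)
    (hm : m ∈ D.patch i k) : l ∈ D.patch i (k + 1) :=
  mem_patch_succ.2 ⟨m, hm, h⟩

variable (D) in
theorem patch_mono (i : Fin N) : Monotone (D.patch i) :=
  monotone_nat_of_le_succ fun _ l hl => (D.neighbour_self l).mem_patch hl

theorem mem_patch_self (i : Fin N) (k : ℕ) : i ∈ D.patch i k :=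
  D.patch_mono i (Nat.zero_le k) (mem_patch_zero.2 rfl)

/-- The relation between the centre of a patch and the subdomains in it is symmetric. -/
theorem mem_patch_symm {i l : Fin N} {k : ℕ} (h : l ∈ D.patch i k) : i ∈ D.patch l k := by
  -- a chain of neighbours can be extended at its beginning
  have key : ∀ k (i m l : Fin N), D.Neighbour i m → l ∈ D.patch m k → l ∈ D.patch i (k + 1) := by
    intro k
    induction k with
    | zero =>
      intro i m l him hl
      rw [mem_patch_zero.1 hl]
      exact mem_patch_one.2 him
    | succ k ih =>
      intro i m l him hl
      obtain ⟨n, hn, hnl⟩ := mem_patch_succ.1 hl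
      exact hnl.mem_patch (ih i m n him hn)
  induction k generalizing l with
  | zero => rw [mem_patch_zero.1 h]; exact mem_patch_self _ _
  | succ k ih =>
    obtain ⟨m, hm, hml⟩ := mem_patch_succ.1 h
    exact key k l m i hml.symm (ih hm)

end Decomposition

/-! ### Exponential decay for local variational problems -/

/-- A form that is split over the subdomains of a decomposition, together with a decomposition
`u = ∑ cut j u` of the elements of the space, where `cut j u` lives on the neighbours of the
subdomain `j`. Elements of `null l` are to be thought of as vanishing on the subdomain `l`. A cut
of `u` over an index set `A` is bounded by the part of `u` on the subdomains near `A`. -/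
structure LocalSplitting {d N : ℕ} {Ω : Set (Pt d)} {T : Mesh Ω} (D : Decomposition T N)
    (F : Type*) [AddCommGroup F] [Module ℂ F] (κ : ℝ) where
  form : Fin N → SesqForm F
  form_nonneg : ∀ l, IsHermitianNonneg (form l)
  null : Fin N → Submodule ℂ F
  form_null : ∀ l, ∀ u ∈ null l, ∀ v, form l u v = 0
  cut : Fin N → F →ₗ[ℂ] F
  sum_cut : ∀ u, ∑ j, cut j u = u
  cut_mem : ∀ j l, ¬ D.Neighbour j l → ∀ u, cut j u ∈ null l
  cut_le : ∀ (A S : Finset (Fin N)), (∀ j ∈ A, ∀ l, D.Neighbour j l → l ∈ S) → ∀ u,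
    ∑ l, sqNorm (form l) (∑ j ∈ A, cut j u) ≤ κ * ∑ l ∈ S, sqNorm (form l) u

namespace LocalSplitting

variable {d N : ℕ} {Ω : Set (Pt d)} {T : Mesh Ω} {D : Decomposition T N}
  {F : Type*} [AddCommGroup F] [Module ℂ F] {κ : ℝ} (Y : LocalSplitting D F κ)

/-- The sum of the local forms. -/
def total : SesqForm F := ∑ l, Y.form l

/-- The part of `u` that is cut out by the index set `A`. -/
def cutOn (A : Finset (Fin N)) (u : F) : F := ∑ j ∈ A, Y.cut j u

/-- The elements that live on the patch of `k` layers around the subdomain `i`. -/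
def onPatch (i : Fin N) (k : ℕ) : Submodule ℂ F := ⨅ l, ⨅ _ : l ∉ D.patch i k, Y.null l

/-- The energy of `u` outside the patch of `k` layers around the subdomain `i`. -/
def tail (i : Fin N) (u : F) (k : ℕ) : ℝ := ∑ l ∈ (D.patch i k)ᶜ, sqNorm (Y.form l) u

theorem mem_onPatch {i : Fin N} {k : ℕ} {u : F} :
    u ∈ Y.onPatch i k ↔ ∀ l, l ∉ D.patch i k → u ∈ Y.null l := by
  simp [onPatch]

theorem total_nonneg : IsHermitianNonneg Y.total :=
  IsHermitianNonneg.sum _ fun l _ => Y.form_nonneg l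

theorem total_apply (u v : F) : Y.total u v = ∑ l, Y.form l u v := by
  simp [total, LinearMap.sum_apply]

theorem sqNorm_total (u : F) : sqNorm Y.total u = ∑ l, sqNorm (Y.form l) u :=
  sqNorm_sum_form _ _ _

theorem form_null_right {l : Fin N} (u : F) {v : F} (hv : v ∈ Y.null l) : Y.form l u v = 0 := by
  rw [(Y.form_nonneg l).hermitian v u, Y.form_null l v hv, map_zero]

theorem cutOn_mem_null {A : Finset (Fin N)} {l : Fin N} (h : ∀ j ∈ A, ¬ D.Neighbour j l) (u : F) :
    Y.cutOn A u ∈ Y.null l :=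
  Submodule.sum_mem _ fun j hj => Y.cut_mem j l (h j hj) u

theorem cutOn_add_compl (A : Finset (Fin N)) (u : F) : Y.cutOn A u + Y.cutOn Aᶜ u = u := by
  rw [cutOn, cutOn, Finset.sum_add_sum_compl, Y.sum_cut]

theorem tail_le_total (i : Fin N) (u : F) (k : ℕ) : Y.tail i u k ≤ sqNorm Y.total u := by
  rw [sqNorm_total]
  exact Finset.sum_le_sum_of_subset_of_nonneg (Finset.subset_univ _)
    fun l _ _ => (Y.form_nonneg l).sqNorm_nonneg u

theorem tail_sub_tail (i : Fin N) (u : F) {k k' : ℕ} (h : k ≤ k') :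
    Y.tail i u k - Y.tail i u k' = ∑ l ∈ D.patch i k' \ D.patch i k, sqNorm (Y.form l) u := by
  rw [sub_eq_iff_eq_add, tail, tail,
    ← Finset.sum_union (Finset.disjoint_left.2 fun l hl hl' => by simp_all)]
  congr 1
  ext l
  have h0 : l ∈ D.patch i k → l ∈ D.patch i k' := fun hl => D.patch_mono i h hl
  by_cases h1 : l ∈ D.patch i k <;> by_cases h2 : l ∈ D.patch i k' <;> simp_all

theorem tail_anti (i : Fin N) (u : F) : Antitone (Y.tail i u) := fun k k' h => by
  have := Y.tail_sub_tail i u h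
  have h0 : 0 ≤ ∑ l ∈ D.patch i k' \ D.patch i k, sqNorm (Y.form l) u :=
    Finset.sum_nonneg fun l _ => (Y.form_nonneg l).sqNorm_nonneg u
  linarith

theorem sum_form_le (s : Finset (Fin N)) (u v : F) :
    ∑ l ∈ s, |(Y.form l u v).re| ≤
      √(∑ l ∈ s, sqNorm (Y.form l) u) * √(∑ l ∈ s, sqNorm (Y.form l) v) := by
  refine (Finset.sum_le_sum fun l _ => (Y.form_nonneg l).abs_re_apply_le u v).trans ?_
  exact Real.sum_sqrt_mul_sqrt_le s (fun l => (Y.form_nonneg l).sqNorm_nonneg u)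
    (fun l => (Y.form_nonneg l).sqNorm_nonneg v)

/-- The energy outside a patch is controlled by the energy in the layers around the boundary of the
patch. The equation is tested with the part of `ψ` outside the patch. -/
theorem tail_le_sqrt_mul (hκ : 0 ≤ κ) {i : Fin N} {ψ : F}
    (hψ : ∀ v ∈ Y.null i, Y.total ψ v = 0) (m : ℕ) :
    Y.tail i ψ (m + 2) ≤ √κ * (Y.tail i ψ m - Y.tail i ψ (m + 4)) := by
  set v := Y.cutOn (D.patch i (m + 1))ᶜ ψ with hv
  -- the part of `v` that matters on the patch of `m + 2` layers
  set v' := Y.cutOn (D.patch i (m + 3) \ D.patch i (m + 1)) ψ with hv'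
  have hmono := D.patch_mono i
  have hin : ∀ l ∈ D.patch i m, v ∈ Y.null l := fun l hl =>
    Y.cutOn_mem_null (fun j hj hjl => by
      rw [Finset.mem_compl] at hj
      exact hj (hjl.symm.mem_patch hl)) ψ
  have hout : ∀ l, l ∉ D.patch i (m + 2) → ψ - v ∈ Y.null l := fun l hl => by
    have : ψ - v = Y.cutOn (D.patch i (m + 1)) ψ := by
      rw [hv, sub_eq_iff_eq_add, Y.cutOn_add_compl]
    rw [this]
    exact Y.cutOn_mem_null (fun j hj hjl => hl (hjl.mem_patch hj)) ψ
  have hmid : ∀ l ∈ D.patch i (m + 2), v - v' ∈ Y.null l := fun l hl => by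
    have : v - v' = Y.cutOn (D.patch i (m + 3))ᶜ ψ := by
      rw [sub_eq_iff_eq_add, hv, hv', cutOn, cutOn, cutOn,
        ← Finset.sum_union (Finset.disjoint_left.2 fun j hj hj' => by simp_all)]
      refine Finset.sum_congr ?_ fun _ _ => rfl
      ext j
      have h0 : j ∈ D.patch i (m + 1) → j ∈ D.patch i (m + 3) := fun hj => hmono (by omega) hj
      by_cases h1 : j ∈ D.patch i (m + 1) <;> by_cases h2 : j ∈ D.patch i (m + 3) <;> simp_all
    rw [this]
    exact Y.cutOn_mem_null (fun j hj hjl => by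
      rw [Finset.mem_compl] at hj
      exact hj (hjl.symm.mem_patch hl)) ψ
  have h0 : ∑ l, (Y.form l ψ v).re = 0 := by
    have := hψ v (hin i (Decomposition.mem_patch_self i m))
    rw [total_apply] at this
    rw [← Complex.re_sum, this, Complex.zero_re]
  rw [← Finset.sum_add_sum_compl (D.patch i (m + 2))] at h0
  have h1 : ∑ l ∈ (D.patch i (m + 2))ᶜ, (Y.form l ψ v).re = Y.tail i ψ (m + 2) := by
    refine Finset.sum_congr rfl fun l hl => ?_
    have := Y.form_null_right ψ (hout l (Finset.mem_compl.1 hl))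
    rw [map_sub, sub_eq_zero] at this
    rw [← this, sqNorm]
  have h2 : ∑ l ∈ D.patch i (m + 2), (Y.form l ψ v).re
      = ∑ l ∈ D.patch i (m + 2) \ D.patch i m, (Y.form l ψ v').re := by
    rw [← Finset.sum_sdiff (hmono (show m ≤ m + 2 by omega)),
      Finset.sum_eq_zero (s := D.patch i m) fun l hl => by
        rw [Y.form_null_right ψ (hin l hl), Complex.zero_re], add_zero]
    refine Finset.sum_congr rfl fun l hl => ?_
    have := Y.form_null_right ψ (hmid l (Finset.mem_sdiff.1 hl).1)
    rw [map_sub, sub_eq_zero] at this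
    rw [this]
  set R := Y.tail i ψ m - Y.tail i ψ (m + 4) with hR
  have hR0 : 0 ≤ R := sub_nonneg.2 (Y.tail_anti i ψ (by omega))
  have h3 : ∑ l ∈ D.patch i (m + 2) \ D.patch i m, sqNorm (Y.form l) ψ ≤ R := by
    rw [← Y.tail_sub_tail i ψ (by omega)]
    exact sub_le_sub_left (Y.tail_anti i ψ (by omega)) _
  have h4 : ∑ l ∈ D.patch i (m + 2) \ D.patch i m, sqNorm (Y.form l) v' ≤ κ * R := by
    rw [hR, Y.tail_sub_tail i ψ (by omega)]
    refine (Finset.sum_le_sum_of_subset_of_nonneg (Finset.subset_univ _)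
      fun l _ _ => (Y.form_nonneg l).sqNorm_nonneg _).trans ?_
    refine Y.cut_le _ _ (fun j hj l hjl => ?_) ψ
    rw [Finset.mem_sdiff] at hj ⊢
    exact ⟨hjl.mem_patch hj.1, fun hl => hj.2 (hjl.symm.mem_patch hl)⟩
  have h5 : Y.tail i ψ (m + 2)
      ≤ ∑ l ∈ D.patch i (m + 2) \ D.patch i m, |(Y.form l ψ v').re| := by
    refine le_trans ?_ (Finset.abs_sum_le_sum_abs _ _)
    rw [← h2, ← h1]
    refine le_trans (le_of_eq ?_) (neg_le_abs _)
    linarith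
  calc Y.tail i ψ (m + 2) ≤ √R * √(κ * R) :=
        h5.trans ((Y.sum_form_le _ _ _).trans
          (mul_le_mul (Real.sqrt_le_sqrt h3) (Real.sqrt_le_sqrt h4)
            (Real.sqrt_nonneg _) (Real.sqrt_nonneg _)))
    _ = √κ * R := by
        rw [Real.sqrt_mul hκ]
        linear_combination √κ * Real.mul_self_sqrt hR0

/-- Exponential decay of the energy outside the patches. -/
theorem tail_four_mul_le (hκ : 0 < κ) {i : Fin N} {ψ : F}
    (hψ : ∀ v ∈ Y.null i, Y.total ψ v = 0) (n : ℕ) :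
    (1 + 1 / √κ) ^ n * Y.tail i ψ (4 * n) ≤ sqNorm Y.total ψ := by
  induction n with
  | zero => simpa using Y.tail_le_total i ψ 0
  | succ n ih =>
    refine le_trans ?_ ih
    have hs : 0 < √κ := Real.sqrt_pos.2 hκ
    have h1 := Y.tail_le_sqrt_mul hκ.le hψ (4 * n)
    have h2 := Y.tail_anti i ψ (show 4 * n + 2 ≤ 4 * n + 4 by omega)
    have h3 : (1 + 1 / √κ) * Y.tail i ψ (4 * n + 4) ≤ Y.tail i ψ (4 * n) := by
      have h4 : Y.tail i ψ (4 * n + 4) / √κ ≤ Y.tail i ψ (4 * n) - Y.tail i ψ (4 * n + 4) := by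
        rw [div_le_iff₀ hs]; linarith
      have e : (1 + 1 / √κ) * Y.tail i ψ (4 * n + 4)
          = Y.tail i ψ (4 * n + 4) + Y.tail i ψ (4 * n + 4) / √κ := by ring
      linarith
    rw [pow_succ, mul_assoc]
    exact mul_le_mul_of_nonneg_left h3 (by positivity)

/-- The Galerkin approximation minimizes the error. -/
theorem sqNorm_sub_le_of_galerkin {c : SesqForm F} (hc : IsHermitianNonneg c) {W : Submodule ℂ F}
    {ψ p v : F} (hp : p ∈ W) (h : ∀ v ∈ W, c p v = c ψ v) (hv : v ∈ W) :
    sqNorm c (ψ - p) ≤ sqNorm c (ψ - v) := by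
  have h1 : c (ψ - p) (p - v) = 0 := by
    rw [map_sub c, LinearMap.sub_apply, h _ (W.sub_mem hp hv), sub_self]
  have h2 := hc.sqNorm_add (ψ - p) (p - v)
  rw [sub_add_sub_cancel, h1, Complex.zero_re] at h2
  linarith [hc.sqNorm_nonneg (p - v)]

/-- The error of the localized solution is bounded by the energy outside a slightly smaller
patch. -/
theorem galerkin_error_le_tail {i : Fin N} {m : ℕ} {ψ p : F} (hp : p ∈ Y.onPatch i (m + 2))
    (h : ∀ v ∈ Y.onPatch i (m + 2), Y.total p v = Y.total ψ v) :
    sqNorm Y.total (ψ - p) ≤ κ * Y.tail i ψ m := by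
  have hv : Y.cutOn (D.patch i (m + 1)) ψ ∈ Y.onPatch i (m + 2) :=
    Y.mem_onPatch.2 fun l hl =>
      Y.cutOn_mem_null (fun j hj hjl => hl (hjl.mem_patch hj)) ψ
  refine (sqNorm_sub_le_of_galerkin Y.total_nonneg hp h hv).trans ?_
  have e : ψ - Y.cutOn (D.patch i (m + 1)) ψ = Y.cutOn (D.patch i (m + 1))ᶜ ψ := by
    rw [sub_eq_iff_eq_add', Y.cutOn_add_compl]
  rw [e, sqNorm_total]
  refine Y.cut_le _ _ (fun j hj l hjl => ?_) ψ
  rw [Finset.mem_compl] at hj ⊢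
  exact fun hl => hj (hjl.symm.mem_patch hl)

/-- The errors of the localized solutions are almost orthogonal, so that they can be summed up with
a factor that grows like the number of subdomains in a patch. -/
theorem sqNorm_sum_error_le (hκ : 0 ≤ κ) {m ν : ℕ}
    (hν : ∀ i, (D.patch i (m + 4)).card ≤ ν) {ψ p : Fin N → F}
    (hψ : ∀ i, ∀ v ∈ Y.null i, Y.total (ψ i) v = 0)
    (hp : ∀ i, p i ∈ Y.onPatch i (m + 2))
    (h : ∀ i, ∀ v ∈ Y.onPatch i (m + 2), Y.total (p i) v = Y.total (ψ i) v) :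
    sqNorm Y.total (∑ i, (ψ i - p i)) ≤ κ * ν * ∑ i, sqNorm Y.total (ψ i - p i) := by
  set w := ∑ i, (ψ i - p i) with hw
  have hc := Y.total_nonneg
  have hmono := fun i => D.patch_mono i
  set A : Fin N → Finset (Fin N) := fun i => D.patch i (m + 3) \ D.patch i (m + 1) with hA
  -- the error is orthogonal to the functions on the patch and to those off the patch
  have h1 : ∀ i, Y.total (ψ i - p i) w = Y.total (ψ i - p i) (Y.cutOn (A i) w) := by
    intro i
    have e : w = Y.cutOn (D.patch i (m + 1)) w + Y.cutOn (A i) w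
        + Y.cutOn (D.patch i (m + 3))ᶜ w := by
      conv_lhs => rw [← Y.cutOn_add_compl (D.patch i (m + 3)) w]
      congr 1
      rw [cutOn, cutOn, cutOn, add_comm (∑ j ∈ D.patch i (m + 1), Y.cut j w),
        Finset.sum_sdiff (hmono i (show m + 1 ≤ m + 3 by omega))]
    conv_lhs => rw [e]
    rw [map_add, map_add]
    have e1 : Y.total (ψ i - p i) (Y.cutOn (D.patch i (m + 1)) w) = 0 := by
      rw [map_sub, LinearMap.sub_apply, h i, sub_self]
      exact Y.mem_onPatch.2 fun l hl =>
        Y.cutOn_mem_null (fun j hj hjl => hl (hjl.mem_patch hj)) w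
    have e2 : Y.total (ψ i - p i) (Y.cutOn (D.patch i (m + 3))ᶜ w) = 0 := by
      have hoff : ∀ l ∈ D.patch i (m + 2), Y.cutOn (D.patch i (m + 3))ᶜ w ∈ Y.null l :=
        fun l hl => Y.cutOn_mem_null (fun j hj hjl => by
          rw [Finset.mem_compl] at hj
          exact hj (hjl.symm.mem_patch hl)) w
      rw [map_sub, LinearMap.sub_apply, hψ i _ (hoff i (Decomposition.mem_patch_self i _)),
        zero_sub, neg_eq_zero, total_apply]
      refine Finset.sum_eq_zero fun l _ => ?_
      by_cases hl : l ∈ D.patch i (m + 2)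
      · exact Y.form_null_right _ (hoff l hl)
      · exact Y.form_null l _ (Y.mem_onPatch.1 (hp i) l hl) _
    rw [e1, e2, zero_add, add_zero]
  have h2 : ∀ i, sqNorm Y.total (Y.cutOn (A i) w)
      ≤ κ * ∑ l ∈ D.patch i (m + 4), sqNorm (Y.form l) w := by
    intro i
    rw [sqNorm_total]
    exact Y.cut_le _ _ (fun j hj l hjl => hjl.mem_patch (Finset.mem_sdiff.1 hj).1) w
  have h3 : ∑ i, sqNorm Y.total (Y.cutOn (A i) w) ≤ κ * ν * sqNorm Y.total w := by
    refine (Finset.sum_le_sum fun i _ => h2 i).trans ?_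
    rw [← Finset.mul_sum, mul_assoc]
    refine mul_le_mul_of_nonneg_left ?_ hκ
    have e : ∀ i, ∑ l ∈ D.patch i (m + 4), sqNorm (Y.form l) w
        = ∑ l, if i ∈ D.patch l (m + 4) then sqNorm (Y.form l) w else 0 := by
      intro i
      rw [← Finset.sum_filter]
      refine Finset.sum_congr ?_ fun _ _ => rfl
      ext l
      simpa using ⟨Decomposition.mem_patch_symm, Decomposition.mem_patch_symm⟩
    simp only [e]
    rw [Finset.sum_comm, sqNorm_total, Finset.mul_sum]
    refine Finset.sum_le_sum fun l _ => ?_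
    rw [Finset.sum_ite_mem, Finset.univ_inter, Finset.sum_const, nsmul_eq_mul]
    exact mul_le_mul_of_nonneg_right (by exact_mod_cast hν l) ((Y.form_nonneg l).sqNorm_nonneg w)
  have h4 : sqNorm Y.total w ≤ √(∑ i, sqNorm Y.total (ψ i - p i)) *
      √(∑ i, sqNorm Y.total (Y.cutOn (A i) w)) := by
    have e : sqNorm Y.total w = ∑ i, (Y.total (ψ i - p i) (Y.cutOn (A i) w)).re := by
      simp only [← h1]
      rw [sqNorm, ← Complex.re_sum, ← LinearMap.sum_apply, ← map_sum]
    rw [e]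
    refine (Finset.sum_le_sum fun i _ => hc.re_apply_le _ _).trans ?_
    exact Real.sum_sqrt_mul_sqrt_le _ (fun i => hc.sqNorm_nonneg _) (fun i => hc.sqNorm_nonneg _)
  have hw0 := hc.sqNorm_nonneg w
  have hS0 : 0 ≤ ∑ i, sqNorm Y.total (ψ i - p i) := Finset.sum_nonneg fun i _ => hc.sqNorm_nonneg _
  rcases hw0.eq_or_lt with h0 | hpos
  · rw [← h0]; positivity
  have h5 : sqNorm Y.total w ^ 2
      ≤ (∑ i, sqNorm Y.total (ψ i - p i)) * (κ * ν * sqNorm Y.total w) := by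
    calc sqNorm Y.total w ^ 2 ≤ _ := pow_le_pow_left₀ hw0 h4 2
      _ = (∑ i, sqNorm Y.total (ψ i - p i)) * ∑ i, sqNorm Y.total (Y.cutOn (A i) w) := by
          rw [mul_pow, Real.sq_sqrt hS0,
            Real.sq_sqrt (Finset.sum_nonneg fun i _ => hc.sqNorm_nonneg _)]
      _ ≤ _ := mul_le_mul_of_nonneg_left h3 hS0
  nlinarith

end LocalSplitting

/-! ### Counting the subdomains of a patch -/

theorem Mesh.volume_region_diff {d : ℕ} {Ω : Set (Pt d)} (T : Mesh Ω) (S : Finset (Fin T.card)) :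
    volume (T.region S \ ⋃ t ∈ S, T.elem t) = 0 := by
  refine measure_mono_null (t := ⋃ t ∈ S, frontier (T.elem t)) ?_
    ((measure_biUnion_null_iff S.countable_toSet).2 fun t _ => T.volume_frontier t)
  rintro x ⟨hx, hx'⟩
  obtain ⟨t, ht, hxt⟩ := Set.mem_iUnion₂.1 hx
  refine Set.mem_iUnion₂.2 ⟨t, ht, hxt, fun hi => hx' ?_⟩
  exact Set.mem_iUnion₂.2 ⟨t, ht, interior_subset hi⟩

namespace Decomposition

variable {d N : ℕ} {Ω : Set (Pt d)} {T : Mesh Ω} {D : Decomposition T N} {σ H : ℝ}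

theorem IsRegular.dist_le_of_mem_patch (hD : D.IsRegular σ H) {i j : Fin N} {k : ℕ}
    (hj : j ∈ D.patch i k) {x y : Pt d} (hx : x ∈ T.region (D.sub i))
    (hy : y ∈ T.region (D.sub j)) : dist x y ≤ (k + 1) * H := by
  induction k generalizing j y with
  | zero =>
    rw [mem_patch_zero] at hj
    subst hj
    simpa using hD.dist_le _ x hx y hy
  | succ k ih =>
    obtain ⟨m, hm, z, hz, hz'⟩ := mem_patch_succ.1 hj
    have h1 := ih hm hz
    have h2 := hD.dist_le j z hz' y hy
    have h3 := dist_triangle x z y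
    push_cast
    linarith

/-- Volume comparison: the subdomains of a patch contain essentially disjoint balls of radius `σH`,
and the patch is contained in a ball of radius `(k+1)H`. -/
theorem IsRegular.card_patch_le (hD : D.IsRegular σ H) (hσ : 0 < σ) (hH : 0 < H) (i : Fin N)
    (k : ℕ) : ((D.patch i k).card : ℝ) ≤ ((k + 1) / σ) ^ d := by
  obtain ⟨x, hx⟩ := D.region_sub_nonempty i
  choose z hz using hD.ball_subset
  set r := σ * H with hr
  have hr0 : 0 < r := mul_pos hσ hH
  set R := (k + 1) * H with hR
  have hR0 : 0 ≤ R := by positivity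
  set U : Fin N → Set (Pt d) := fun j => ⋃ t ∈ D.sub j, T.elem t with hU
  have hUo : ∀ j, IsOpen (U j) := fun j => isOpen_biUnion fun t _ => T.isOpen_elem t
  have hdisj : ∀ j j', j ≠ j' → Disjoint (U j) (U j') := by
    intro j j' hjj
    rw [Set.disjoint_left]
    intro y hy hy'
    obtain ⟨t, ht, hyt⟩ := Set.mem_iUnion₂.1 hy
    obtain ⟨t', ht', hyt'⟩ := Set.mem_iUnion₂.1 hy'
    have hne : t ≠ t' := fun e =>
      Finset.disjoint_left.1 (D.sub_disjoint j j' hjj) ht (e ▸ ht')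
    exact Set.disjoint_left.1 (T.disjoint_elem t t' hne) hyt hyt'
  have h1 : ∀ j, volume (Metric.ball (z j) r) ≤ volume (Metric.ball (z j) r ∩ U j) := by
    intro j
    have hsub : Metric.ball (z j) r ⊆ (Metric.ball (z j) r ∩ U j) ∪ (T.region (D.sub j) \ U j) := by
      intro y hy
      by_cases h : y ∈ U j
      · exact Or.inl ⟨hy, h⟩
      · exact Or.inr ⟨hz j hy, h⟩
    refine (measure_mono hsub).trans ((measure_union_le _ _).trans ?_)
    rw [T.volume_region_diff, add_zero]
  have h2 : ∑ j ∈ D.patch i k, volume (Metric.ball (z j) r ∩ U j)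
      ≤ volume (Metric.closedBall x R) := by
    rw [← measure_biUnion_finset]
    · refine measure_mono (Set.iUnion₂_subset fun j hj y hy => ?_)
      rw [Metric.mem_closedBall, dist_comm]
      exact hD.dist_le_of_mem_patch hj hx (hz j hy.1)
    · intro j _ j' _ hjj
      exact (hdisj j j' hjj).mono Set.inter_subset_right Set.inter_subset_right
    · exact fun j _ => (Metric.isOpen_ball.inter (hUo j)).measurableSet
  have h3 : ((D.patch i k).card : ℝ≥0∞)
        * (ENNReal.ofReal (r ^ d) * volume (Metric.ball (0 : Pt d) 1))
      ≤ ENNReal.ofReal (R ^ d) * volume (Metric.ball (0 : Pt d) 1) := by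
    have e1 := fun j => Measure.addHaar_ball_of_pos (volume : Measure (Pt d)) (z j) hr0
    have e2 := Measure.addHaar_closedBall (volume : Measure (Pt d)) x hR0
    rw [finrank_euclideanSpace_fin] at e2
    simp only [finrank_euclideanSpace_fin] at e1
    calc _ = ∑ j ∈ D.patch i k, volume (Metric.ball (z j) r) := by
          simp only [e1, Finset.sum_const, nsmul_eq_mul]
      _ ≤ _ := (Finset.sum_le_sum fun j _ => h1 j).trans h2
      _ = _ := e2
  rw [← mul_assoc] at h3
  have h4 := (ENNReal.mul_le_mul_iff_left (Metric.measure_ball_pos volume (0 : Pt d) one_pos).ne'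
    measure_ball_lt_top.ne).1 h3
  rw [← ENNReal.ofReal_natCast, ← ENNReal.ofReal_mul (Nat.cast_nonneg _),
    ENNReal.ofReal_le_ofReal_iff (by positivity)] at h4
  have h5 : ((k : ℝ) + 1) / σ = R / r := by rw [hR, hr]; field_simp
  rw [h5, div_pow, le_div_iff₀ (by positivity)]
  exact h4

theorem mem_overlapSet {i j : Fin N} : j ∈ D.overlapSet i ↔ (D.ext j ∩ D.ext i).Nonempty := by
  simp [overlapSet]

theorem mem_overlapSet_comm {i j : Fin N} : j ∈ D.overlapSet i ↔ i ∈ D.overlapSet j := by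
  rw [mem_overlapSet, mem_overlapSet, Finset.inter_comm]

theorem card_overlapSet_le (i : Fin N) : (D.overlapSet i).card ≤ D.M :=
  Finset.le_sup (f := fun i => (D.overlapSet i).card) (Finset.mem_univ i)

theorem self_mem_overlapSet (i : Fin N) : i ∈ D.overlapSet i := by
  rw [mem_overlapSet, Finset.inter_self]
  exact (D.sub_nonempty i).mono (D.sub_subset_ext i)

theorem one_le_M (i : Fin N) : 1 ≤ D.M :=
  le_trans (Finset.card_pos.2 ⟨i, self_mem_overlapSet i⟩) (card_overlapSet_le i)

theorem IsRegular.neighbour_of_mem (hD : D.IsRegular σ H) {j l : Fin N} {t : Fin T.card}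
    (ht : t ∈ D.ext j) (ht' : t ∈ D.sub l) : D.Neighbour j l := by
  obtain ⟨m, hm, htm⟩ := Finset.mem_biUnion.1 (hD.ext_subset j ht)
  have : m = l := by
    by_contra hne
    exact Finset.disjoint_left.1 (D.sub_disjoint m l hne) htm ht'
  exact this ▸ mem_patch_one.1 hm

/-- Shape regularity bounds the number `M` of overlapping subdomains. -/
theorem IsRegular.M_le (hD : D.IsRegular σ H) (hσ : 0 < σ) (hH : 0 < H) :
    (D.M : ℝ) ≤ (3 / σ) ^ d := by
  have hle : ∀ i, ((D.overlapSet i).card : ℝ) ≤ (3 / σ) ^ d := by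
    intro i
    have hsub : D.overlapSet i ⊆ D.patch i 2 := by
      intro j hj
      obtain ⟨t, ht⟩ := mem_overlapSet.1 hj
      rw [Finset.mem_inter] at ht
      obtain ⟨l, hl⟩ := D.sub_cover t
      have h1 := hD.neighbour_of_mem ht.2 hl
      have h2 := hD.neighbour_of_mem ht.1 hl
      exact h2.symm.mem_patch (mem_patch_one.2 h1)
    have h1 : ((D.overlapSet i).card : ℝ) ≤ (D.patch i 2).card := by
      exact_mod_cast Finset.card_le_card hsub
    have h2 := hD.card_patch_le hσ hH i 2
    norm_num at h2
    exact h1.trans h2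
  have h0 : (0 : ℝ) ≤ (3 / σ) ^ d := by positivity
  rw [← Nat.le_floor_iff h0]
  exact Finset.sup_le fun i _ => Nat.le_floor (hle i)

end Decomposition

namespace Discretization

variable {d N : ℕ} {Ω : Set (Pt d)} {T : Mesh Ω} {D : Decomposition T N} {P : PartitionUnity D}
  {X : Discretization D P}

/-! ### The local forms and the spectral projections -/

theorem aOn_nonneg (S : Finset (Fin T.card)) : IsHermitianNonneg (X.aOn S) :=
  IsHermitianNonneg.sum _ fun t _ => X.aElem_hermitian t

theorem a_nonneg : IsHermitianNonneg X.a := X.aOn_nonneg _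

theorem aOn_local {S : Finset (Fin T.card)} {u : X.V}
    (hu : ∀ t ∈ S, T.VanishesOn t (u : L2 Ω)) (v : X.V) : X.aOn S u v = 0 := by
  simp only [aOn, LinearMap.sum_apply]
  exact Finset.sum_eq_zero fun t ht => X.aElem_local t u v (hu t ht)

theorem sqNorm_aOn (S : Finset (Fin T.card)) (u : X.V) :
    sqNorm (X.aOn S) u = ∑ t ∈ S, sqNorm (X.aElem t) u :=
  sqNorm_sum_form _ _ _

theorem sqNorm_a_pos {u : X.V} (hu : u ≠ 0) : 0 < sqNorm X.a u := by
  rw [a, sqNorm_aOn]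
  exact X.a_posDef u hu

theorem ι_injective : Function.Injective X.ι := Submodule.inclusion_injective X.Vh_le

theorem sqNorm_a_ι_pos {u : X.Vh} (hu : u ≠ 0) : 0 < sqNorm X.a (X.ι u) :=
  sqNorm_a_pos fun h => hu (X.ι_injective (by rw [h, map_zero]))

theorem sum_aSub : ∑ l, X.aSub l = X.a := by
  have h : (Finset.univ : Finset (Fin T.card)) = Finset.univ.biUnion D.sub := by
    ext t
    simpa using D.sub_cover t
  rw [a, aOn, h, Finset.sum_biUnion fun i _ j _ hij => D.sub_disjoint i j hij]
  rfl

theorem sum_sqNorm_aSub (u : X.V) : ∑ l, sqNorm (X.aSub l) u = sqNorm X.a u := by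
  rw [← sum_aSub, sqNorm_sum_form]

theorem mem_VhOn_compl {S : Finset (Fin T.card)} {u : X.Vh} :
    u ∈ X.VhOn Sᶜ ↔ ∀ t ∈ S, T.VanishesOn t (u : L2 Ω) := by
  simp [VhOn, Mesh.supportedIn]

/-- On functions supported in a region, the form `a` agrees with its restriction to the region. -/
theorem aOn_eq_a {S : Finset (Fin T.card)} {u : X.Vh} (hu : u ∈ X.VhOn S) (v : X.V) :
    X.aOn S (X.ι u) v = X.a (X.ι u) v := by
  rw [a, aOn, aOn, LinearMap.sum_apply, LinearMap.sum_apply, LinearMap.sum_apply,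
    LinearMap.sum_apply]
  refine Finset.sum_subset (Finset.subset_univ S) fun t _ ht => ?_
  exact X.aElem_local t _ _ (hu t ht)

section Spectral

variable {i : Fin N} (e : X.LocalEigenbasis i) (Λ : ℝ)

/-- The expansion of `s_i` and `a_i` in the eigenfunctions. -/
theorem s_eq_sum (v w : X.Vh) :
    X.s i (X.ι v) (X.ι w)
      = ∑ j, X.s i (X.ι v) (X.ι (e.φ j)) * X.s i (X.ι (e.φ j)) (X.ι w) ∧
    X.aSub i (X.ι v) (X.ι w)
      = ∑ j, (e.ev j : ℂ) * (X.s i (X.ι v) (X.ι (e.φ j)) * X.s i (X.ι (e.φ j)) (X.ι w)) := by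
  obtain ⟨c, hc⟩ := e.complete v
  have hs : ∀ w, X.s i (X.ι v) (X.ι w) = ∑ j, c j * X.s i (X.ι (e.φ j)) (X.ι w) := by
    intro w
    have := X.s_local i (X.ι (v - ∑ j, c j • e.φ j)) (X.ι w) hc
    rw [map_sub, map_sub, LinearMap.sub_apply, sub_eq_zero] at this
    rw [this]
    simp [LinearMap.sum_apply]
  have ha : X.aSub i (X.ι v) (X.ι w) = ∑ j, c j * X.aSub i (X.ι (e.φ j)) (X.ι w) := by
    have := aOn_local (X := X) (u := X.ι (v - ∑ j, c j • e.φ j)) hc (X.ι w)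
    rw [map_sub, map_sub, LinearMap.sub_apply, sub_eq_zero] at this
    rw [aSub, this]
    simp [LinearMap.sum_apply]
  have hcoef : ∀ j, X.s i (X.ι v) (X.ι (e.φ j)) = c j := by
    intro j
    rw [hs]
    simp [e.orthonormal]
  simp only [hcoef]
  refine ⟨hs w, ha.trans (Finset.sum_congr rfl fun j _ => ?_)⟩
  rw [e.eigen]
  ring

theorem coef_mul_conj (v : X.Vh) (j : Fin e.n) :
    X.s i (X.ι v) (X.ι (e.φ j)) * X.s i (X.ι (e.φ j)) (X.ι v)
      = ((‖X.s i (X.ι v) (X.ι (e.φ j))‖ ^ 2 : ℝ) : ℂ) := by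
  rw [(X.s_hermitian i).hermitian (X.ι v) (X.ι (e.φ j)), Complex.mul_conj,
    Complex.normSq_eq_norm_sq]

theorem sqNorm_s_eq (v : X.Vh) :
    sqNorm (X.s i) (X.ι v) = ∑ j, ‖X.s i (X.ι v) (X.ι (e.φ j))‖ ^ 2 := by
  rw [sqNorm, (s_eq_sum e v v).1]
  simp only [coef_mul_conj]
  rw [← Complex.ofReal_sum, Complex.ofReal_re]

theorem sqNorm_aSub_eq (v : X.Vh) :
    sqNorm (X.aSub i) (X.ι v) = ∑ j, e.ev j * ‖X.s i (X.ι v) (X.ι (e.φ j))‖ ^ 2 := by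
  rw [sqNorm, (s_eq_sum e v v).2]
  simp only [coef_mul_conj, ← Complex.ofReal_mul]
  rw [← Complex.ofReal_sum, Complex.ofReal_re]

theorem ev_nonneg (j : Fin e.n) : 0 ≤ e.ev j := by
  have h1 : sqNorm (X.aSub i) (X.ι (e.φ j)) = e.ev j := by
    rw [sqNorm, e.eigen, e.orthonormal, if_pos rfl, mul_one, Complex.ofReal_re]
  rw [← h1]
  exact (aOn_nonneg _).sqNorm_nonneg _

theorem s_proj_apply (v w : X.Vh) :
    X.s i (X.ι (e.proj Λ v)) (X.ι w)
      = ∑ j ∈ e.selected Λ, X.s i (X.ι v) (X.ι (e.φ j)) * X.s i (X.ι (e.φ j)) (X.ι w) := by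
  simp [LocalEigenbasis.proj, LinearMap.sum_apply]

theorem sqNorm_s_proj_eq (v : X.Vh) :
    sqNorm (X.s i) (X.ι (e.proj Λ v))
      = ∑ j ∈ e.selected Λ, ‖X.s i (X.ι v) (X.ι (e.φ j))‖ ^ 2 := by
  have h : X.s i (X.ι (e.proj Λ v)) (X.ι (e.proj Λ v))
      = ∑ j ∈ e.selected Λ, ((‖X.s i (X.ι v) (X.ι (e.φ j))‖ ^ 2 : ℝ) : ℂ) := by
    rw [s_proj_apply]
    refine Finset.sum_congr rfl fun j hj => ?_
    rw [← coef_mul_conj, (X.s_hermitian i).hermitian (X.ι (e.proj Λ v)), e.s_proj Λ v hj,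
      ← (X.s_hermitian i).hermitian (X.ι v)]
  rw [sqNorm, h, ← Complex.ofReal_sum, Complex.ofReal_re]

theorem sqNorm_s_proj_le (v : X.Vh) :
    sqNorm (X.s i) (X.ι (e.proj Λ v)) ≤ sqNorm (X.s i) (X.ι v) := by
  rw [sqNorm_s_proj_eq, sqNorm_s_eq e]
  exact Finset.sum_le_sum_of_subset_of_nonneg (Finset.subset_univ _) fun _ _ _ => by positivity

/-- The spectral estimate `‖v‖² ≤ ‖π_i v‖² + Λ a_i(v,v)`. -/
theorem sqNorm_s_le (hΛ : 0 ≤ Λ) (v : X.Vh) :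
    sqNorm (X.s i) (X.ι v)
      ≤ sqNorm (X.s i) (X.ι (e.proj Λ v)) + Λ * sqNorm (X.aSub i) (X.ι v) := by
  rw [sqNorm_s_proj_eq, sqNorm_s_eq e, sqNorm_aSub_eq e, Finset.mul_sum, LocalEigenbasis.selected,
    Finset.sum_filter, ← Finset.sum_add_distrib]
  refine Finset.sum_le_sum fun j _ => ?_
  have h0 := ev_nonneg e j
  split_ifs with h
  · exact le_add_of_nonneg_right (by positivity)
  · rw [zero_add, ← mul_assoc]
    exact le_mul_of_one_le_left (by positivity) (not_le.1 h).le

/-- The projection `π_i` as a linear map. -/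
def projₗ : X.Vh →ₗ[ℂ] X.Vh where
  toFun := e.proj Λ
  map_add' u v := by
    simp [LocalEigenbasis.proj, add_smul, Finset.sum_add_distrib]
  map_smul' c u := by
    simp [LocalEigenbasis.proj, Finset.smul_sum, mul_smul]

theorem s_ι_local {v : X.Vh} (hv : v ∈ X.VhOn (D.sub i)ᶜ) (w : X.V) : X.s i (X.ι v) w = 0 :=
  X.s_local i _ _ (mem_VhOn_compl.1 hv)

theorem s_proj_local (w : X.V) {v : X.Vh} (hv : v ∈ X.VhOn (D.sub i)ᶜ) :
    X.s i w (X.ι (e.proj Λ v)) = 0 := by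
  have h : e.proj Λ v = 0 := by
    simp [LocalEigenbasis.proj, s_ι_local hv]
  rw [h, map_zero, map_zero]

end Spectral

/-! ### Cutting off with the partition of unity -/

theorem mulθ_coe (j : Fin N) (u : X.Vh) : ((X.mulθ j u : X.V) : L2 Ω) = P.θ j • (u : L2 Ω) := rfl

/-- Multiplication by `θ_j` as a linear map. -/
def mulθₗ (j : Fin N) : X.Vh →ₗ[ℂ] X.V where
  toFun := X.mulθ j
  map_add' u v := Subtype.ext (Lp.add_smul _ _ _)
  map_smul' c u := by
    refine Subtype.ext (Lp.ext ?_)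
    change (P.θ j • (c • (u : L2 Ω)) : L2 Ω) =ᵐ[_] (c • (P.θ j • (u : L2 Ω) : L2 Ω) : L2 Ω)
    filter_upwards [Lp.coeFn_lpSMul (r := 2) (P.θ j) (c • (u : L2 Ω)), Lp.coeFn_smul c (u : L2 Ω),
      Lp.coeFn_lpSMul (r := 2) (P.θ j) (u : L2 Ω),
      Lp.coeFn_smul c (P.θ j • (u : L2 Ω) : L2 Ω)] with x h1 h2 h3 h4
    rw [h1, h4, Pi.smul_apply', h2, Pi.smul_apply, Pi.smul_apply, h3, Pi.smul_apply', smul_comm]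

theorem sum_mulθ_coe (A : Finset (Fin N)) (u : X.Vh) :
    ((∑ j ∈ A, X.mulθ j u : X.V) : L2 Ω) = (∑ j ∈ A, P.θ j : LInf Ω) • (u : L2 Ω) := by
  classical
  induction A using Finset.induction_on with
  | empty => simp
  | insert j A hj ih =>
    rw [Finset.sum_insert hj, Finset.sum_insert hj, Submodule.coe_add, ih, mulθ_coe, Lp.smul_add]

theorem ae_sum_θ (A : Finset (Fin N)) :
    ∀ᵐ x ∂(volume.restrict Ω), (∑ j ∈ A, P.θ j : LInf Ω) x = ∑ j ∈ A, P.θ j x := by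
  filter_upwards [Lp.coeFn_finsetSum A P.θ] with x hx
  rw [hx, Finset.sum_apply]

theorem sum_mulθ (u : X.Vh) : ∑ j, X.mulθ j u = X.ι u := by
  refine Subtype.ext ?_
  rw [sum_mulθ_coe]
  refine Lp.ext ?_
  filter_upwards [Lp.coeFn_lpSMul (r := 2) (∑ j, P.θ j : LInf Ω) (u : L2 Ω), ae_sum_θ Finset.univ,
    P.sum_eq_one] with x h1 h2 h3
  rw [h1, Pi.smul_apply', h2, h3, one_smul]
  rfl

theorem mulθ_vanishesOn {j : Fin N} {t : Fin T.card} (ht : t ∉ D.ext j) (u : X.Vh) :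
    T.VanishesOn t (X.mulθ j u : L2 Ω) := by
  rw [mulθ_coe]
  filter_upwards [T.ae_elem_of_ae (Lp.coeFn_lpSMul (r := 2) (P.θ j) (u : L2 Ω)), P.support j t ht]
    with x h1 h2
  rw [h1, Pi.smul_apply', h2, zero_smul]

theorem sum_mulθ_vanishesOn {A : Finset (Fin N)} {t : Fin T.card} (ht : ∀ j ∈ A, t ∉ D.ext j)
    (u : X.Vh) : T.VanishesOn t ((∑ j ∈ A, X.mulθ j u : X.V) : L2 Ω) := by
  have : ((∑ j ∈ A, X.mulθ j u : X.V) : L2 Ω) ∈ T.supportedIn {t}ᶜ := by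
    rw [Submodule.coe_sum]
    refine Submodule.sum_mem _ fun j hj t' ht' => ?_
    simp only [Finset.mem_compl, Finset.mem_singleton, not_not] at ht'
    exact ht' ▸ mulθ_vanishesOn (ht j hj) u
  exact this t (by simp)

/-- A sum of functions of the partition of unity has values in `[0, 1]`. -/
theorem sqNorm_s_sum_mulθ_le {Ct : ℝ} (h : X.CutoffStable Ct) (A : Finset (Fin N)) (l : Fin N)
    (u : X.Vh) : sqNorm (X.s l) (∑ j ∈ A, X.mulθ j u) ≤ sqNorm (X.s l) (X.ι u) := by
  have h1 := h.mul_le l (∑ j ∈ A, P.θ j) u _ (sum_mulθ_coe A u)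
  have hae : ∀ᵐ x ∂(volume.restrict Ω), ‖(∑ j ∈ A, P.θ j : LInf Ω) x‖ ≤ 1 := by
    filter_upwards [ae_sum_θ (P := P) A, P.sum_eq_one, ae_all_iff.2 P.mem_Icc] with x h1 h2 h3
    rw [h1, Real.norm_of_nonneg (Finset.sum_nonneg fun j _ => (h3 j).1), ← h2]
    exact Finset.sum_le_sum_of_subset_of_nonneg (Finset.subset_univ A) fun j _ _ => (h3 j).1
  have hae' : ∀ᵐ x ∂(volume.restrict (T.region (D.sub l))), ‖(∑ j ∈ A, P.θ j : LInf Ω) x‖ ≤ 1 := by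
    refine ae_mono (Measure.restrict_mono' ?_ le_rfl) hae
    rw [ae_le_set]
    refine measure_mono_null ?_ (T.volume_region_diff (D.sub l))
    exact Set.sdiff_subset_sdiff_right (Set.iUnion₂_subset fun t _ => T.elem_subset t)
  have h2 : (eLpNorm (∑ j ∈ A, P.θ j : LInf Ω) ∞
      (volume.restrict (T.region (D.sub l)))).toReal ≤ 1 := by
    rw [eLpNorm_exponent_top]
    refine ENNReal.toReal_le_of_le_ofReal zero_le_one (eLpNormEssSup_le_of_ae_bound hae')
  have h3 := h1.trans (mul_le_of_le_one_left (Real.sqrt_nonneg _) h2)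
  exact (Real.sqrt_le_sqrt_iff ((X.s_hermitian l).sqNorm_nonneg _)).1 h3

theorem sqNorm_aSub_sum_mulθ_le {Ct : ℝ} (hCt : 0 ≤ Ct) (h : X.CutoffStable Ct)
    (A : Finset (Fin N)) (l : Fin N) (u : X.Vh) :
    sqNorm (X.aSub l) (∑ j ∈ A, X.mulθ j u)
      ≤ D.M ^ 2 * Ct * (sqNorm (X.aSub l) (X.ι u) + sqNorm (X.s l) (X.ι u)) := by
  set q := sqNorm (X.aSub l) (X.ι u) + sqNorm (X.s l) (X.ι u) with hq
  have hq0 : 0 ≤ q :=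
    add_nonneg ((aOn_nonneg _).sqNorm_nonneg _) ((X.s_hermitian l).sqNorm_nonneg _)
  have hM : ((A ∩ D.overlapSet l).card : ℝ) ≤ D.M := by
    exact_mod_cast (Finset.card_le_card Finset.inter_subset_right).trans
      (Decomposition.card_overlapSet_le l)
  -- only the `θ_j` with `j` in the overlap set of `l` are alive on the subdomain `l`
  have h1 : sqNorm (X.aSub l) (∑ j ∈ A, X.mulθ j u)
      = sqNorm (X.aSub l) (∑ j ∈ A ∩ D.overlapSet l, X.mulθ j u) := by
    refine (aOn_nonneg _).sqNorm_congr_of_null fun w => aOn_local ?_ w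
    intro t ht
    have e : ∑ j ∈ A, X.mulθ j u - ∑ j ∈ A ∩ D.overlapSet l, X.mulθ j u
        = ∑ j ∈ A \ D.overlapSet l, X.mulθ j u := by
      rw [sub_eq_iff_eq_add', Finset.sum_inter_add_sum_sdiff]
    rw [e]
    refine sum_mulθ_vanishesOn (fun j hj htj => (Finset.mem_sdiff.1 hj).2 ?_) u
    exact Decomposition.mem_overlapSet.2 ⟨t, Finset.mem_inter.2 ⟨htj, D.sub_subset_ext l ht⟩⟩
  rw [h1]
  refine ((aOn_nonneg _).sqNorm_sum_le _ _).trans ?_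
  have h2 : ∑ j ∈ A ∩ D.overlapSet l, sqNorm (X.aSub l) (X.mulθ j u) ≤ D.M * (Ct * q) := by
    refine (Finset.sum_le_sum fun j hj => h.energy_le u l j (Finset.mem_inter.1 hj).2).trans ?_
    rw [Finset.sum_const, nsmul_eq_mul]
    exact mul_le_mul_of_nonneg_right hM (by positivity)
  calc _ ≤ (D.M : ℝ) * (D.M * (Ct * q)) :=
        mul_le_mul hM h2 (Finset.sum_nonneg fun j _ => (aOn_nonneg _).sqNorm_nonneg _)
          (Nat.cast_nonneg _)
    _ = _ := by ring

end Discretization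

/-! ### The splitting of the form `b` -/

/-- The stability constant of `u ↦ I_h(χ u)` with respect to the form `b`, for a sum `χ` of
functions of the partition of unity. -/
def cutConst (Ct CI M Λ : ℝ) : ℝ := CI * (Ct * M ^ 2 + 1) * (1 + Λ)

/-- The bound for the energy of the decomposition `u = u₀ + ∑ I_h(θ_j (u - u₀))`, relative to the
energy of `u`; the parameter `B` bounds the relative localization error. -/
def stableConst (Ct CI M Λ B : ℝ) : ℝ :=
  2 + (2 * (M ^ 2 * Ct) + CI * (Ct * M)) * ((1 + Λ) * (2 * (1 + B)))

namespace Discretization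

variable {d N : ℕ} {Ω : Set (Pt d)} {T : Mesh Ω} {D : Decomposition T N} {P : PartitionUnity D}
  {X : Discretization D P}

section Splitting

variable (X) in
/-- The part of the form `b` that belongs to the subdomain `Ω_l`. -/
def bSub (e : ∀ i, X.LocalEigenbasis i) (Λ : ℝ) (l : Fin N) : SesqForm X.Vh :=
  (X.aSub l).pullback X.ι + (X.s l).pullback (X.ι ∘ₗ projₗ (e l) Λ)

variable {e : ∀ i, X.LocalEigenbasis i} {Λ : ℝ}

theorem bSub_apply (l : Fin N) (u v : X.Vh) :
    X.bSub e Λ l u v = X.aSub l (X.ι u) (X.ι v)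
      + X.s l (X.ι ((e l).proj Λ u)) (X.ι ((e l).proj Λ v)) := rfl

theorem sqNorm_bSub (l : Fin N) (u : X.Vh) :
    sqNorm (X.bSub e Λ l) u
      = sqNorm (X.aSub l) (X.ι u) + sqNorm (X.s l) (X.ι ((e l).proj Λ u)) :=
  sqNorm_add_form _ _ _

theorem bSub_nonneg (l : Fin N) : IsHermitianNonneg (X.bSub e Λ l) :=
  ((aOn_nonneg _).pullback _).add ((X.s_hermitian l).pullback _)

theorem energy_le_bSub (hΛ : 0 ≤ Λ) (l : Fin N) (u : X.Vh) :
    sqNorm (X.aSub l) (X.ι u) + sqNorm (X.s l) (X.ι u) ≤ (1 + Λ) * sqNorm (X.bSub e Λ l) u := by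
  have h1 := sqNorm_s_le (e l) Λ hΛ u
  have h2 := (X.s_hermitian l).sqNorm_nonneg (X.ι ((e l).proj Λ u))
  rw [sqNorm_bSub]
  nlinarith

variable {Ih : X.V →ₗ[ℂ] X.Vh} {Ct CIa CIs : ℝ}

theorem interpolation_aSub_le (h2 : X.InterpolationStable Ih CIa CIs) (l : Fin N) (w : X.V) :
    sqNorm (X.aSub l) (X.ι (Ih w)) ≤ max CIa CIs * sqNorm (X.aSub l) w := by
  rw [aSub, sqNorm_aOn, sqNorm_aOn, Finset.mul_sum]
  refine Finset.sum_le_sum fun t _ => (h2.a_le w t).trans ?_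
  exact mul_le_mul_of_nonneg_right (le_max_left _ _) ((X.aElem_hermitian t).sqNorm_nonneg _)

theorem interpolation_a_le (h2 : X.InterpolationStable Ih CIa CIs) (w : X.V) :
    sqNorm X.a (X.ι (Ih w)) ≤ max CIa CIs * sqNorm X.a w := by
  rw [← sum_sqNorm_aSub, ← sum_sqNorm_aSub, Finset.mul_sum]
  exact Finset.sum_le_sum fun l _ => interpolation_aSub_le h2 l w

theorem interpolation_mem (hIh : X.IsInterpolation Ih) {S : Finset (Fin T.card)} {w : X.V}
    (hw : ∀ t ∈ S, T.VanishesOn t (w : L2 Ω)) : Ih w ∈ X.VhOn Sᶜ :=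
  mem_VhOn_compl.2 fun t ht => hIh.elementwise t w (hw t ht)

theorem sum_sqNorm_bSub_interpolation_le (h2 : X.InterpolationStable Ih CIa CIs) (w : X.V) :
    ∑ l, sqNorm (X.bSub e Λ l) (Ih w)
      ≤ max CIa CIs * ∑ l, (sqNorm (X.aSub l) w + sqNorm (X.s l) w) := by
  simp only [sqNorm_bSub]
  rw [Finset.sum_add_distrib, Finset.sum_add_distrib, mul_add]
  refine add_le_add ?_ ?_
  · rw [Finset.mul_sum]
    exact Finset.sum_le_sum fun l _ => interpolation_aSub_le h2 l w
  · refine (Finset.sum_le_sum fun l _ => sqNorm_s_proj_le (e l) Λ (Ih w)).trans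
      ((h2.s_le w).trans ?_)
    exact mul_le_mul_of_nonneg_right (le_max_right _ _)
      (Finset.sum_nonneg fun l _ => (X.s_hermitian l).sqNorm_nonneg _)

theorem bSub_local {l : Fin N} {u : X.Vh} (hu : u ∈ X.VhOn (D.sub l)ᶜ) (v : X.Vh) :
    X.bSub e Λ l u v = 0 := by
  have h : X.s l (X.ι ((e l).proj Λ v)) (X.ι ((e l).proj Λ u)) = 0 := s_proj_local (e l) Λ _ hu
  have h' : X.aSub l (X.ι u) (X.ι v) = 0 := aOn_local (u := X.ι u) (mem_VhOn_compl.1 hu) (X.ι v)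
  rw [bSub_apply, h', zero_add, (X.s_hermitian l).hermitian (X.ι ((e l).proj Λ v)), h, map_zero]

theorem sum_mulθ_vanishesOn_sub {σ H : ℝ} (hD : D.IsRegular σ H) {A : Finset (Fin N)} {l : Fin N}
    (h : ∀ j ∈ A, ¬ D.Neighbour j l) (u : X.Vh) :
    ∀ t ∈ D.sub l, T.VanishesOn t ((∑ j ∈ A, X.mulθ j u : X.V) : L2 Ω) := fun _ ht =>
  sum_mulθ_vanishesOn (fun j hj htj => h j hj (hD.neighbour_of_mem htj ht)) u

theorem sum_sqNorm_bSub_cut_le {σ H : ℝ} (hD : D.IsRegular σ H) (hΛ : 0 ≤ Λ) (hCt : 0 ≤ Ct)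
    (hCIa : 0 ≤ CIa) (h1 : X.CutoffStable Ct) (h2 : X.InterpolationStable Ih CIa CIs)
    {A S : Finset (Fin N)} (hAS : ∀ j ∈ A, ∀ l, D.Neighbour j l → l ∈ S) (u : X.Vh) :
    ∑ l, sqNorm (X.bSub e Λ l) (Ih (∑ j ∈ A, X.mulθ j u))
      ≤ cutConst Ct (max CIa CIs) D.M Λ * ∑ l ∈ S, sqNorm (X.bSub e Λ l) u := by
  refine (sum_sqNorm_bSub_interpolation_le h2 _).trans ?_
  rw [cutConst, mul_assoc, mul_assoc]
  refine mul_le_mul_of_nonneg_left ?_ (hCIa.trans (le_max_left _ _))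
  have hout : ∀ l, l ∉ S → ∀ t ∈ D.sub l,
      T.VanishesOn t ((∑ j ∈ A, X.mulθ j u : X.V) : L2 Ω) := fun l hl =>
    sum_mulθ_vanishesOn_sub hD (fun j hj hjl => hl (hAS j hj l hjl)) u
  rw [← Finset.sum_subset (Finset.subset_univ S) fun l _ hl => by
    rw [sqNorm, sqNorm, aSub, aOn_local (hout l hl), X.s_local l _ _ (hout l hl),
      Complex.zero_re, add_zero]]
  rw [Finset.mul_sum, Finset.mul_sum]
  refine Finset.sum_le_sum fun l _ => ?_
  have h3 := sqNorm_aSub_sum_mulθ_le hCt h1 A l u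
  have h4 := sqNorm_s_sum_mulθ_le h1 A l u
  have h5 := energy_le_bSub (e := e) hΛ l u
  have h6 : 0 ≤ sqNorm (X.aSub l) (X.ι u) := (aOn_nonneg _).sqNorm_nonneg _
  have h7 : (0 : ℝ) ≤ Ct * D.M ^ 2 + 1 := by positivity
  refine le_trans ?_ (mul_le_mul_of_nonneg_left h5 h7)
  linarith

variable (X) in
/-- The form `b`, split over the subdomains, with the cut-offs `u ↦ I_h(θ_j u)`. -/
def splitting {σ H : ℝ} (hD : D.IsRegular σ H) (e : ∀ i, X.LocalEigenbasis i) (hΛ : 0 ≤ Λ)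
    (hIh : X.IsInterpolation Ih) (hCt : 0 ≤ Ct) (hCIa : 0 ≤ CIa) (h1 : X.CutoffStable Ct)
    (h2 : X.InterpolationStable Ih CIa CIs) :
    LocalSplitting D X.Vh (cutConst Ct (max CIa CIs) D.M Λ) where
  form := X.bSub e Λ
  form_nonneg := bSub_nonneg
  null l := X.VhOn (D.sub l)ᶜ
  form_null _ _ hu v := bSub_local hu v
  cut j := Ih ∘ₗ mulθₗ j
  sum_cut u := by
    change ∑ j, Ih (X.mulθ j u) = u
    rw [← map_sum, sum_mulθ, hIh.apply_eq]
  cut_mem j l hjl u := by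
    change Ih (X.mulθ j u) ∈ _
    exact interpolation_mem hIh fun t ht =>
      mulθ_vanishesOn (fun h => hjl (hD.neighbour_of_mem h ht)) u
  cut_le A S hAS u := by
    change ∑ l, sqNorm (X.bSub e Λ l) (∑ j ∈ A, Ih (X.mulθ j u)) ≤ _
    rw [← map_sum]
    exact sum_sqNorm_bSub_cut_le hD hΛ hCt hCIa h1 h2 hAS u

variable {σ H : ℝ} (hD : D.IsRegular σ H) (hΛ : 0 ≤ Λ)
    (hIh : X.IsInterpolation Ih) (hCt : 0 ≤ Ct) (hCIa : 0 ≤ CIa) (h1 : X.CutoffStable Ct)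
    (h2 : X.InterpolationStable Ih CIa CIs)

theorem splitting_total_apply (u v : X.Vh) :
    (X.splitting hD e hΛ hIh hCt hCIa h1 h2).total u v = X.b e Λ u v := by
  rw [LocalSplitting.total_apply, b, ← sum_aSub, LinearMap.sum_apply, LinearMap.sum_apply,
    ← Finset.sum_add_distrib]
  rfl

theorem sqNorm_splitting_total (u : X.Vh) :
    sqNorm (X.splitting hD e hΛ hIh hCt hCIa h1 h2).total u
      = sqNorm X.a (X.ι u) + ∑ l, sqNorm (X.s l) (X.ι ((e l).proj Λ u)) := by
  rw [LocalSplitting.sqNorm_total, ← sum_sqNorm_aSub, ← Finset.sum_add_distrib]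
  exact Finset.sum_congr rfl fun l _ => sqNorm_bSub l u

theorem splitting_onPatch (i : Fin N) (k : ℕ) :
    (X.splitting hD e hΛ hIh hCt hCIa h1 h2).onPatch i k = X.VhOn (D.patchElems i k) := by
  ext u
  rw [LocalSplitting.mem_onPatch]
  constructor
  · intro h t ht
    obtain ⟨l, hl⟩ := D.sub_cover t
    exact mem_VhOn_compl.1
      (h l fun hlp => ht (Finset.mem_biUnion.2 ⟨l, hlp, hl⟩)) t hl
  · intro h l hl
    refine mem_VhOn_compl.2 fun t ht => h t fun htp => ?_
    obtain ⟨m, hm, htm⟩ := Finset.mem_biUnion.1 htp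
    have : m = l := by
      by_contra hne
      exact Finset.disjoint_left.1 (D.sub_disjoint m l hne) htm ht
    exact hl (this ▸ hm)

end Splitting

/-! ### The coarse approximation -/

section Coarse

variable {e : ∀ i, X.LocalEigenbasis i} {Λ : ℝ}

variable (X) in
/-- The set `tildeV` as a subspace. -/
def tildeSubmodule (e : ∀ i, X.LocalEigenbasis i) (Λ : ℝ) : Submodule ℂ X.Vh where
  carrier := X.tildeV e Λ
  add_mem' hu hv i j hj := by simp [hu i j hj, hv i j hj]
  zero_mem' i j _ := by simp
  smul_mem' c u hu i j hj := by simp [hu i j hj]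

/-- The Poincaré bound extends from `V_0` to `V_h`, since `V_h` is the `a`-orthogonal sum of `V_0`
and `Ṽ`, and the projections vanish on `Ṽ`. -/
theorem sum_sqNorm_proj_le {C : ℝ} (hC : 0 ≤ C) (h : X.PoincareBound e Λ C) (u : X.Vh) :
    ∑ l, sqNorm (X.s l) (X.ι ((e l).proj Λ u)) ≤ C * sqNorm X.a (X.ι u) := by
  have ha : IsHermitianNonneg (X.a.pullback X.ι) := a_nonneg.pullback _
  obtain ⟨p, hp, hpa⟩ := exists_galerkin (X.tildeSubmodule e Λ) (X.a.pullback X.ι)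
    (X.a.pullback X.ι) (fun u _ hu => sqNorm_a_ι_pos hu) u
  have hproj : ∀ l, (e l).proj Λ (u - p) = (e l).proj Λ u := by
    intro l
    refine Finset.sum_congr rfl fun j hj => ?_
    have := hp l j hj
    rw [map_sub, map_sub, LinearMap.sub_apply, this, sub_zero]
  have h0 : u - p ∈ X.V0 e Λ := by
    intro v hv
    have := hpa v hv
    rw [SesqForm.pullback_apply, SesqForm.pullback_apply] at this
    rw [map_sub, map_sub, LinearMap.sub_apply, this, sub_self]
  have h1 := h _ h0
  simp only [hproj] at h1
  refine h1.trans (mul_le_mul_of_nonneg_left ?_ hC)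
  have h2 := LocalSplitting.sqNorm_sub_le_of_galerkin ha hp hpa (Submodule.zero_mem _)
  rwa [sub_zero] at h2

theorem proj_φ {i : Fin N} (ei : X.LocalEigenbasis i) {j : Fin ei.n} (hj : j ∈ ei.selected Λ) :
    ei.proj Λ (ei.φ j) = ei.φ j := by
  simp [LocalEigenbasis.proj, ei.orthonormal, hj]

variable {Ih : X.V →ₗ[ℂ] X.Vh} {Ct CIa CIs : ℝ} {σ H : ℝ}

/-- The localized solutions lie in the coarse space. -/
theorem exists_localized_solution (hD : D.IsRegular σ H) (hΛ : 0 ≤ Λ)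
    (hIh : X.IsInterpolation Ih) (hCt : 0 ≤ Ct) (hCIa : 0 ≤ CIa) (h1 : X.CutoffStable Ct)
    (h2 : X.InterpolationStable Ih CIa CIs) (k : ℕ) (i : Fin N) (u : X.Vh) :
    ∃ p ∈ X.coarseSpace e Λ k, p ∈ X.VhOn (D.patchElems i k) ∧
      ∀ v ∈ X.VhOn (D.patchElems i k),
        (X.splitting hD e hΛ hIh hCt hCIa h1 h2).total p v
          = X.s i (X.ι ((e i).proj Λ u)) (X.ι ((e i).proj Λ v)) := by
  set c := (X.splitting hD e hΛ hIh hCt hCIa h1 h2).total with hc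
  have hpos : ∀ u ∈ X.VhOn (D.patchElems i k), u ≠ 0 → 0 < sqNorm c u := fun u _ hu => by
    rw [hc, sqNorm_splitting_total]
    exact add_pos_of_pos_of_nonneg (sqNorm_a_ι_pos hu)
      (Finset.sum_nonneg fun l _ => (X.s_hermitian l).sqNorm_nonneg _)
  have hex : ∀ j, ∃ ψ ∈ X.VhOn (D.patchElems i k), ∀ v ∈ X.VhOn (D.patchElems i k),
      c ψ v = X.s i (X.ι ((e i).proj Λ ((e i).φ j))) (X.ι ((e i).proj Λ v)) := fun j =>
    exists_galerkin _ c ((X.s i).pullback (X.ι ∘ₗ projₗ (e i) Λ)) hpos ((e i).φ j)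
  choose ψ hψ hψs using hex
  refine ⟨∑ j ∈ (e i).selected Λ, X.s i (X.ι u) (X.ι ((e i).φ j)) • ψ j, ?_, ?_, ?_⟩
  · refine Submodule.sum_mem _ fun j hj =>
      Submodule.smul_mem _ _ (Submodule.subset_span ⟨i, j, hj, hψ j, fun v hv => ?_⟩)
    rw [← splitting_total_apply hD hΛ hIh hCt hCIa h1 h2, ← hc, hψs j v hv, proj_φ _ hj]
  · exact Submodule.sum_mem _ fun j _ => Submodule.smul_mem _ _ (hψ j)
  · intro v hv
    rw [s_proj_apply, map_sum, LinearMap.sum_apply]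
    refine Finset.sum_congr rfl fun j hj => ?_
    rw [map_smul, LinearMap.smul_apply, hψs j v hv, proj_φ _ hj, smul_eq_mul]

/-- The coarse space approximates every `u`, up to an error whose energy `b` is bounded by the
energy of `u` and the localization error. The approximation is the sum of the localizations of
the solutions `ψ_i` of `b(ψ_i, v) = s_i(π_i u, π_i v)`. -/
theorem exists_coarse_approximation (hD : D.IsRegular σ H) (hΛ : 0 ≤ Λ)
    (hIh : X.IsInterpolation Ih) (hCt : 0 ≤ Ct) (hCIa : 0 < CIa) (h1 : X.CutoffStable Ct)
    (h2 : X.InterpolationStable Ih CIa CIs) {m ν : ℕ}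
    (hν : ∀ i, (D.patch i (m + 4)).card ≤ ν) {κ : ℝ}
    (hκ : κ = cutConst Ct (max CIa CIs) D.M Λ) (u : X.Vh) :
    ∃ u₀ ∈ X.coarseSpace e Λ (m + 2),
      sqNorm X.a (X.ι (u - u₀)) + ∑ l, sqNorm (X.s l) (X.ι ((e l).proj Λ (u - u₀))) ≤
        2 * (sqNorm X.a (X.ι u) + κ * ν * (min 1 (κ / (1 + 1 / √κ) ^ (m / 4))
          * ∑ l, sqNorm (X.s l) (X.ι ((e l).proj Λ u)))) := by
  have hκ0 : 0 < κ := by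
    rw [hκ, cutConst]
    have : 0 < max CIa CIs := lt_max_of_lt_left hCIa
    positivity
  subst hκ
  set κ := cutConst Ct (max CIa CIs) D.M Λ
  set Y := X.splitting hD e hΛ hIh hCt hCIa.le h1 h2 with hY
  have hb : ∀ v, sqNorm Y.total v
      = sqNorm X.a (X.ι v) + ∑ l, sqNorm (X.s l) (X.ι ((e l).proj Λ v)) :=
    sqNorm_splitting_total hD hΛ hIh hCt hCIa.le h1 h2
  have hs0 : ∀ l (v : X.Vh), 0 ≤ sqNorm (X.s l) (X.ι ((e l).proj Λ v)) := fun l v =>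
    (X.s_hermitian l).sqNorm_nonneg _
  have ha0 : ∀ v : X.Vh, 0 ≤ sqNorm X.a (X.ι v) := fun v => a_nonneg.sqNorm_nonneg _
  have hpos : ∀ v ∈ (⊤ : Submodule ℂ X.Vh), v ≠ 0 → 0 < sqNorm Y.total v := fun v _ hv => by
    rw [hb]
    exact add_pos_of_pos_of_nonneg (sqNorm_a_ι_pos hv) (Finset.sum_nonneg fun l _ => hs0 l v)
  have hψ : ∀ i, ∃ ψ, ∀ v, Y.total ψ v
      = X.s i (X.ι ((e i).proj Λ u)) (X.ι ((e i).proj Λ v)) := fun i => by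
    obtain ⟨ψ, -, h⟩ := exists_galerkin ⊤ Y.total
      ((X.s i).pullback (X.ι ∘ₗ projₗ (e i) Λ)) hpos u
    exact ⟨ψ, fun v => h v trivial⟩
  choose ψ hψ using hψ
  choose p hpc hp hps using fun i =>
    exists_localized_solution (e := e) hD hΛ hIh hCt hCIa.le h1 h2 (m + 2) i u
  have hp' : ∀ i, p i ∈ Y.onPatch i (m + 2) := fun i => by
    rw [hY, splitting_onPatch]; exact hp i
  have hgal : ∀ i, ∀ v ∈ Y.onPatch i (m + 2), Y.total (p i) v = Y.total (ψ i) v := by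
    intro i v hv
    rw [hY, splitting_onPatch] at hv
    rw [hψ, ← hps i v hv]
  have hnull : ∀ i, ∀ v ∈ Y.null i, Y.total (ψ i) v = 0 := fun i v hv => by
    rw [hψ]; exact s_proj_local (e i) Λ _ hv
  -- the energy of the solutions
  have hψb : ∀ i, sqNorm Y.total (ψ i) ≤ sqNorm (X.s i) (X.ι ((e i).proj Λ u)) := by
    intro i
    have e1 : sqNorm Y.total (ψ i)
        = (X.s i (X.ι ((e i).proj Λ u)) (X.ι ((e i).proj Λ (ψ i)))).re := by rw [sqNorm, hψ]
    have e2 := (X.s_hermitian i).two_re_apply_le (X.ι ((e i).proj Λ u)) (X.ι ((e i).proj Λ (ψ i)))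
    have e3 : sqNorm (X.s i) (X.ι ((e i).proj Λ (ψ i))) ≤ sqNorm Y.total (ψ i) := by
      rw [hb]
      have := Finset.single_le_sum (f := fun l => sqNorm (X.s l) (X.ι ((e l).proj Λ (ψ i))))
        (fun l _ => hs0 l (ψ i)) (Finset.mem_univ i)
      linarith [ha0 (ψ i)]
    linarith
  -- the localization errors
  have herr : ∀ i, sqNorm Y.total (ψ i - p i) ≤ min 1 (κ / (1 + 1 / √κ) ^ (m / 4))
      * sqNorm (X.s i) (X.ι ((e i).proj Λ u)) := by
    intro i
    rw [min_mul_of_nonneg _ _ (hs0 i u), one_mul]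
    refine le_min ?_ ?_
    · have := LocalSplitting.sqNorm_sub_le_of_galerkin Y.total_nonneg (hp' i) (hgal i)
        (Submodule.zero_mem _)
      rw [sub_zero] at this
      exact this.trans (hψb i)
    · refine (Y.galerkin_error_le_tail (hp' i) (hgal i)).trans ?_
      rw [div_mul_eq_mul_div, mul_div_assoc]
      refine mul_le_mul_of_nonneg_left ?_ hκ0.le
      rw [le_div_iff₀ (by positivity), mul_comm]
      have e1 := Y.tail_four_mul_le hκ0 (hnull i) (m / 4)
      have e2 := Y.tail_anti i (ψ i) (Nat.mul_div_le m 4)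
      refine le_trans ?_ (e1.trans (hψb i))
      exact mul_le_mul_of_nonneg_left e2 (by positivity)
  have hsum : sqNorm Y.total (∑ i, (ψ i - p i)) ≤ κ * ν * (min 1 (κ / (1 + 1 / √κ) ^ (m / 4))
      * ∑ l, sqNorm (X.s l) (X.ι ((e l).proj Λ u))) := by
    refine (Y.sqNorm_sum_error_le hκ0.le hν hnull hp' hgal).trans ?_
    refine mul_le_mul_of_nonneg_left ?_ (by positivity)
    rw [Finset.mul_sum]
    exact Finset.sum_le_sum fun i _ => herr i
  -- the error before localization: `b(u - ∑ ψ_i, v) = a(u, v)`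
  have hglob : sqNorm Y.total (u - ∑ i, ψ i) ≤ sqNorm X.a (X.ι u) := by
    set z := u - ∑ i, ψ i with hz
    have e1 : Y.total z z = X.a (X.ι u) (X.ι z) := by
      have e2 : Y.total u z = X.a (X.ι u) (X.ι z)
          + ∑ l, X.s l (X.ι ((e l).proj Λ u)) (X.ι ((e l).proj Λ z)) :=
        splitting_total_apply hD hΛ hIh hCt hCIa.le h1 h2 u z
      have e3 : Y.total z z = Y.total u z - ∑ i, Y.total (ψ i) z := by
        rw [← LinearMap.sum_apply, ← map_sum, ← LinearMap.sub_apply, ← map_sub]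
      rw [e3, e2]
      simp only [hψ]
      rw [add_sub_cancel_right]
    have e3 := a_nonneg.two_re_apply_le (X.ι u) (X.ι z)
    have e4 : sqNorm X.a (X.ι z) ≤ sqNorm Y.total z := by
      rw [hb]
      linarith [Finset.sum_nonneg fun l (_ : l ∈ Finset.univ) => hs0 l z]
    have e5 : sqNorm Y.total z = (X.a (X.ι u) (X.ι z)).re := by rw [sqNorm, e1]
    linarith
  refine ⟨∑ i, p i, Submodule.sum_mem _ fun i _ => hpc i, ?_⟩
  rw [← hb]
  have e1 : u - ∑ i, p i = (u - ∑ i, ψ i) + ∑ i, (ψ i - p i) := by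
    rw [Finset.sum_sub_distrib]; abel
  rw [e1]
  refine (Y.total_nonneg.sqNorm_add_le _ _).trans ?_
  linarith

end Coarse

/-! ### The stable decomposition -/

section Stable

variable {e : ∀ i, X.LocalEigenbasis i} {Λ : ℝ} {Ih : X.V →ₗ[ℂ] X.Vh} {Ct CIa CIs : ℝ} {σ H : ℝ}

/-- The total energy of the functions `θ_j v`; on `Ω_l` only the `θ_j` in the overlap set of `l`
count. -/
theorem sum_sqNorm_mulθ_le (hCt : 0 ≤ Ct) (h1 : X.CutoffStable Ct) (v : X.Vh) :
    ∑ j, sqNorm X.a (X.mulθ j v)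
      ≤ Ct * D.M * ∑ l, (sqNorm (X.aSub l) (X.ι v) + sqNorm (X.s l) (X.ι v)) := by
  simp only [← sum_sqNorm_aSub]
  rw [Finset.sum_comm, Finset.mul_sum]
  refine Finset.sum_le_sum fun l _ => ?_
  have h0 : 0 ≤ sqNorm (X.aSub l) (X.ι v) + sqNorm (X.s l) (X.ι v) :=
    add_nonneg ((aOn_nonneg _).sqNorm_nonneg _) ((X.s_hermitian l).sqNorm_nonneg _)
  have hout : ∀ j, j ∉ D.overlapSet l → sqNorm (X.aSub l) (X.mulθ j v) = 0 := fun j hj => by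
    have : ∀ t ∈ D.sub l, T.VanishesOn t (X.mulθ j v : L2 Ω) := fun t ht =>
      mulθ_vanishesOn (fun htj => hj (Decomposition.mem_overlapSet.2
        ⟨t, Finset.mem_inter.2 ⟨htj, D.sub_subset_ext l ht⟩⟩)) v
    rw [sqNorm, aSub, aOn_local this, Complex.zero_re]
  rw [← Finset.sum_subset (f := fun j => sqNorm (X.aSub l) (X.mulθ j v))
    (Finset.subset_univ (D.overlapSet l)) fun j _ hj => hout j hj]
  refine (Finset.sum_le_sum fun j hj => h1.energy_le v l j hj).trans ?_
  rw [Finset.sum_const, nsmul_eq_mul, mul_comm Ct (D.M : ℝ), mul_assoc]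
  have hcard : ((D.overlapSet l).card : ℝ) ≤ D.M := by
    exact_mod_cast Decomposition.card_overlapSet_le l
  exact mul_le_mul_of_nonneg_right hcard (mul_nonneg hCt h0)

/-- The energy `a` is bounded by `a + ∑ s_l`, with a factor that contains `C̃`: apply the stability
of the cut-offs to `∑ θ_j = 1`. -/
theorem sqNorm_a_le (hCt : 0 ≤ Ct) (h1 : X.CutoffStable Ct) (v : X.Vh) :
    sqNorm X.a (X.ι v)
      ≤ D.M ^ 2 * Ct * ∑ l, (sqNorm (X.aSub l) (X.ι v) + sqNorm (X.s l) (X.ι v)) := by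
  rw [← sum_sqNorm_aSub, Finset.mul_sum]
  refine Finset.sum_le_sum fun l _ => ?_
  have := sqNorm_aSub_sum_mulθ_le hCt h1 Finset.univ l v
  rwa [sum_mulθ] at this

/-- Every `u` has a decomposition into a function in the coarse space and functions supported in the
overlapping subdomains with a bounded total energy. -/
theorem exists_stable_decomposition (hD : D.IsRegular σ H) (hΛ : 0 ≤ Λ)
    (hIh : X.IsInterpolation Ih) (hCt : 0 ≤ Ct) (hCIa : 0 < CIa) (h1 : X.CutoffStable Ct)
    (h2 : X.InterpolationStable Ih CIa CIs) {m ν : ℕ}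
    (hν : ∀ i, (D.patch i (m + 4)).card ≤ ν) {κ C : ℝ} (hC : 0 ≤ C)
    (h3 : X.PoincareBound e Λ C)
    (hκ : κ = cutConst Ct (max CIa CIs) D.M Λ) (u : X.Vh) :
    ∃ u₀ ∈ X.coarseSpace e Λ (m + 2), ∃ w : Fin N → X.Vh, (∀ j, w j ∈ X.VhOn (D.ext j)) ∧
      u = ∑ j, w j + u₀ ∧
      ∑ j, sqNorm X.a (X.ι (w j)) + sqNorm X.a (X.ι u₀)
        ≤ stableConst Ct (max CIa CIs) D.M Λ
            (κ * ν * (min 1 (κ / (1 + 1 / √κ) ^ (m / 4)) * C)) * sqNorm X.a (X.ι u) := by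
  obtain ⟨u₀, hu₀, herr⟩ := exists_coarse_approximation (e := e) hD hΛ hIh hCt hCIa h1 h2 hν hκ u
  set v := u - u₀ with hv
  set CI := max CIa CIs with hCI
  have hCI0 : 0 < CI := lt_max_of_lt_left hCIa
  have hκ0 : 0 < κ := by
    rw [hκ, cutConst]
    positivity
  set ε := min 1 (κ / (1 + 1 / √κ) ^ (m / 4)) with hε
  have hε0 : 0 ≤ ε := le_min zero_le_one (by positivity)
  set A := sqNorm X.a (X.ι u) with hA
  have hA0 : 0 ≤ A := a_nonneg.sqNorm_nonneg _
  set G := ∑ l, (sqNorm (X.aSub l) (X.ι v) + sqNorm (X.s l) (X.ι v)) with hG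
  have hG1 : G ≤ (1 + Λ) * (2 * (1 + κ * ν * (ε * C)) * A) := by
    have e1 : G ≤ (1 + Λ) * ∑ l, sqNorm (X.bSub e Λ l) v := by
      rw [Finset.mul_sum]
      exact Finset.sum_le_sum fun l _ => energy_le_bSub hΛ l v
    refine e1.trans (mul_le_mul_of_nonneg_left ?_ (by positivity))
    have e2 : ∑ l, sqNorm (X.bSub e Λ l) v
        = sqNorm X.a (X.ι v) + ∑ l, sqNorm (X.s l) (X.ι ((e l).proj Λ v)) := by
      simp only [sqNorm_bSub, Finset.sum_add_distrib, sum_sqNorm_aSub]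
    rw [e2]
    refine herr.trans ?_
    have e3 := mul_le_mul_of_nonneg_left (sum_sqNorm_proj_le hC h3 u)
      (mul_nonneg (mul_nonneg hκ0.le (Nat.cast_nonneg ν)) hε0)
    rw [← hA] at e3
    linarith
  refine ⟨u₀, hu₀, fun j => Ih (X.mulθ j v), fun j t ht => ?_, ?_, ?_⟩
  · exact hIh.elementwise t _ (mulθ_vanishesOn ht v)
  · rw [← map_sum, sum_mulθ, hIh.apply_eq, hv, sub_add_cancel]
  · have e1 : ∑ j, sqNorm X.a (X.ι (Ih (X.mulθ j v))) ≤ CI * (Ct * D.M * G) := by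
      refine le_trans ?_ (mul_le_mul_of_nonneg_left (sum_sqNorm_mulθ_le hCt h1 v) hCI0.le)
      rw [Finset.mul_sum]
      exact Finset.sum_le_sum fun j _ => interpolation_a_le h2 _
    have e2 : sqNorm X.a (X.ι u₀) ≤ 2 * A + 2 * sqNorm X.a (X.ι v) := by
      have : X.ι u₀ = X.ι u - X.ι v := by rw [← map_sub, hv, sub_sub_cancel]
      rw [this]
      exact a_nonneg.sqNorm_sub_le _ _
    have e3 := sqNorm_a_le hCt h1 v
    have e4 := mul_le_mul_of_nonneg_left hG1
      (show 0 ≤ 2 * (D.M ^ 2 * Ct) + CI * (Ct * D.M) by positivity)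
    rw [stableConst]
    rw [← hG] at e3
    linarith

end Stable

/-! ### The preconditioned operator -/

theorem precond_isSchwarzOperator (e : ∀ i, X.LocalEigenbasis i) (Λ : ℝ) (k : ℕ) :
    IsSchwarzOperator (X.a.pullback X.ι) (X.coarseSpace e Λ k) (fun j => X.VhOn (D.ext j))
      (fun u => subspaceCorrection (X.coarseSpace e Λ k) (X.a.pullback X.ι) (X.Ah u))
      (fun j u => subspaceCorrection (X.VhOn (D.ext j))
        ((X.aOn (D.ext j)).pullback X.ι) (X.Ah u))
      (X.precond e Λ k * X.Ah) where
  apply_eq u := by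
    rw [Module.End.mul_apply, precond, LinearMap.add_apply, LinearMap.sum_apply]
  mem₀ u := subspaceCorrection_mem _ _ _
  mem j u := subspaceCorrection_mem _ _ _
  proj₀ u v hv := subspaceCorrection_formOperator _ (X.a.pullback X.ι) (X.a.pullback X.ι)
    (fun u _ hu => sqNorm_a_ι_pos hu) u hv
  proj j u v hv := by
    have h1 := subspaceCorrection_formOperator (X.VhOn (D.ext j))
      ((X.aOn (D.ext j)).pullback X.ι) (X.a.pullback X.ι) (fun u hu hne => by
        rw [sqNorm, SesqForm.pullback_apply, aOn_eq_a hu]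
        exact sqNorm_a_ι_pos hne) u hv
    rw [SesqForm.pullback_apply, aOn_eq_a (subspaceCorrection_mem _ _ _)] at h1
    exact h1

theorem a_eq_zero_of_disjoint {i j : Fin N} (hij : j ∉ D.overlapSet i) {u v : X.Vh}
    (hu : u ∈ X.VhOn (D.ext i)) (hv : v ∈ X.VhOn (D.ext j)) : X.a (X.ι u) (X.ι v) = 0 := by
  rw [a, aOn, LinearMap.sum_apply, LinearMap.sum_apply]
  refine Finset.sum_eq_zero fun t _ => ?_
  by_cases ht : t ∈ D.ext i
  · have htj : t ∉ D.ext j := fun htj =>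
      hij (Decomposition.mem_overlapSet.2 ⟨t, Finset.mem_inter.2 ⟨htj, ht⟩⟩)
    rw [(X.aElem_hermitian t).hermitian (X.ι v), X.aElem_local t _ _ (hv t htj), map_zero]
  · exact X.aElem_local t _ _ (hu t ht)

/-- Since `I_h` reproduces `V_h`, its stability constant is at least `1`. -/
theorem one_le_of_interpolation [Nontrivial X.Vh] {Ih : X.V →ₗ[ℂ] X.Vh} {CIa CIs : ℝ}
    (hIh : X.IsInterpolation Ih) (h2 : X.InterpolationStable Ih CIa CIs) : 1 ≤ max CIa CIs := by
  obtain ⟨u, hu⟩ := exists_ne (0 : X.Vh)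
  have h := interpolation_a_le h2 (X.ι u)
  rw [hIh.apply_eq] at h
  have := sqNorm_a_ι_pos hu
  nlinarith

end Discretization

/-! ### Comparison of the constants -/

/-- The minimum of the two bounds for the localization error decays at least like `(1+1/L)^(-2n)`,
with a factor that does not depend on `x`: for large `x` the factor `x` of the second bound is made
harmless by the decay rate `1 + 1/√x`, which is much better than `1 + 1/L`. -/
theorem min_div_pow_le {x L : ℝ} (hx : 2 ≤ x) (hL : 4 ≤ L) (hxL : 3 / 2 * x ≤ L) (n : ℕ) :
    min 1 (x / (1 + 1 / √x) ^ n) ≤ Real.exp 4 * ((1 + 1 / L) ^ (2 * n))⁻¹ := by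
  set s := √x with hs
  have hs0 : 0 < s := Real.sqrt_pos.2 (by linarith)
  have hsx : s ^ 2 = x := Real.sq_sqrt (by linarith)
  have hL0 : 0 < L := by linarith
  have hE : 0 < (1 + 1 / L) ^ (2 * n) := by positivity
  rw [← div_eq_mul_inv, le_div_iff₀ hE]
  rcases le_or_gt x 4 with hx4 | hx4
  · have h1 : (1 + 1 / L) ^ 2 ≤ 1 + 1 / s := by
      have e1 : 2 / L + 1 / L ^ 2 ≤ 1 / s := by
        have e0 : 2 / L + 1 / L ^ 2 ≤ (9 / 4) / L := by
          rw [div_add_div _ _ hL0.ne' (by positivity), div_le_div_iff₀ (by positivity) hL0]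
          nlinarith [pow_pos hL0 3, pow_pos hL0 2]
        refine e0.trans ?_
        rw [div_le_div_iff₀ hL0 hs0]
        rcases le_or_gt s (7 / 4) with h | h <;> nlinarith
      have e2 : (1 + 1 / L) ^ 2 = 1 + (2 / L + 1 / L ^ 2) := by ring
      linarith
    have h2 : (1 + 1 / L) ^ (2 * n) ≤ (1 + 1 / s) ^ n := by
      rw [pow_mul]
      exact pow_le_pow_left₀ (by positivity) h1 n
    have h3 : 0 < (1 + 1 / s) ^ n := by positivity
    calc _ ≤ x / (1 + 1 / s) ^ n * (1 + 1 / s) ^ n :=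
          mul_le_mul (min_le_right _ _) h2 hE.le (by positivity)
      _ = x := div_mul_cancel₀ _ h3.ne'
      _ ≤ _ := by linarith [Real.add_one_le_exp (4 : ℝ)]
  · have hs2 : 2 ≤ s := by nlinarith
    set y := n * Real.log (1 + 1 / s) with hy
    set t := 16 / (9 * s) with ht
    have hlog : 3 / (4 * s) ≤ Real.log (1 + 1 / s) := by
      refine le_trans ?_ (Real.le_log_one_add_of_nonneg (by positivity))
      have : 2 * (1 / s) / (1 / s + 2) = 2 / (1 + 2 * s) := by field_simp
      rw [this, div_le_div_iff₀ (by positivity) (by positivity)]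
      linarith
    have hpow : (1 + 1 / s) ^ n = Real.exp y := by
      rw [hy, mul_comm, Real.exp_mul, Real.exp_log (by positivity), Real.rpow_natCast]
    have hEt : (1 + 1 / L) ^ (2 * n) ≤ Real.exp (t * y) := by
      calc (1 + 1 / L) ^ (2 * n) ≤ Real.exp (1 / L) ^ (2 * n) :=
            pow_le_pow_left₀ (by positivity) (by linarith [Real.add_one_le_exp (1 / L)]) _
        _ = Real.exp (2 * n * (1 / L)) := by
            rw [← Real.exp_nat_mul]; push_cast; ring_nf
        _ ≤ Real.exp (t * y) := by
            rw [Real.exp_le_exp]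
            have e1 : 1 / L ≤ 2 / (3 * s ^ 2) := by
              rw [div_le_div_iff₀ hL0 (by positivity)]; linarith
            have e2 : t * y = n * (t * Real.log (1 + 1 / s)) := by rw [hy]; ring
            have e3 : 4 / (3 * s ^ 2) ≤ t * Real.log (1 + 1 / s) := by
              calc 4 / (3 * s ^ 2) = t * (3 / (4 * s)) := by rw [ht]; field_simp; norm_num
                _ ≤ _ := mul_le_mul_of_nonneg_left hlog (by positivity)
            have e4 : 2 * (1 / L) ≤ 4 / (3 * s ^ 2) := by
              calc 2 * (1 / L) ≤ 2 * (2 / (3 * s ^ 2)) := by linarith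
                _ = _ := by ring
            rw [e2]
            calc 2 * (n : ℝ) * (1 / L) = n * (2 * (1 / L)) := by ring
              _ ≤ _ := mul_le_mul_of_nonneg_left (e4.trans e3) (Nat.cast_nonneg n)
    have hl0 : 0 ≤ Real.log s := Real.log_nonneg (by linarith)
    have hls : Real.log s ≤ s := (Real.log_le_sub_one_of_pos hs0).trans (by linarith)
    have htl : 2 * t * Real.log s ≤ 4 := by
      have : 2 * t * Real.log s = 32 / 9 * (Real.log s / s) := by rw [ht]; ring
      rw [this]
      have : Real.log s / s ≤ 1 := (div_le_one hs0).2 hls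
      linarith
    have ht0 : 0 ≤ t := by positivity
    have ht1 : t ≤ 1 := by
      rw [ht, div_le_one (by positivity)]; linarith
    rw [hpow]
    rcases le_or_gt y (2 * Real.log s) with h | h
    · calc _ ≤ 1 * Real.exp (t * y) :=
            mul_le_mul (min_le_left _ _) hEt hE.le zero_le_one
        _ ≤ _ := by
            rw [one_mul, Real.exp_le_exp]
            nlinarith
    · have hxe : x = Real.exp (2 * Real.log s) := by
        rw [← hsx, two_mul, Real.exp_add, Real.exp_log hs0, sq]
      calc _ ≤ x / Real.exp y * Real.exp (t * y) :=
            mul_le_mul (min_le_right _ _) hEt hE.le (by positivity)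
        _ = Real.exp (2 * Real.log s - y + t * y) := by
            rw [Real.exp_add, Real.exp_sub, ← hxe]
        _ ≤ _ := by
            rw [Real.exp_le_exp]
            nlinarith

theorem decayBase_gt_one {Ct CI M Λ : ℝ} (hCt : 0 ≤ Ct) (hCI : 0 < CI) (hΛ : 0 ≤ Λ) :
    1 < decayBase Ct CI M Λ := by
  have : 0 < ((3 / 2 * Ct * M ^ 2 + 2) * CI * (1 + Λ))⁻¹ := by positivity
  rw [decayBase]
  linarith

/-- The decay of the localization error in terms of the base `E`, where a decay step takes four
layers. -/
theorem min_div_pow_le_decayBase {Ct CI M Λ : ℝ} (hCt : 0 ≤ Ct) (hCI : 1 ≤ CI) (hΛ : 1 ≤ Λ)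
    (m : ℕ) :
    min 1 (cutConst Ct CI M Λ / (1 + 1 / √(cutConst Ct CI M Λ)) ^ (m / 4))
      ≤ 2 * Real.exp 4 * decayBase Ct CI M Λ ^ (1 - ((m + 2 : ℕ) : ℝ) / 2) := by
  set L := (3 / 2 * Ct * M ^ 2 + 2) * CI * (1 + Λ) with hL
  have hM : 0 ≤ Ct * M ^ 2 := by positivity
  have hCL : 2 ≤ CI * (1 + Λ) := by nlinarith
  have hx : 2 ≤ cutConst Ct CI M Λ := by
    have : cutConst Ct CI M Λ = (Ct * M ^ 2 + 1) * (CI * (1 + Λ)) := by rw [cutConst]; ring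
    rw [this]; nlinarith
  have hL' : L = (3 / 2 * (Ct * M ^ 2) + 2) * (CI * (1 + Λ)) := by rw [hL]; ring
  have hL4 : 4 ≤ L := by rw [hL']; nlinarith
  have hxL : 3 / 2 * cutConst Ct CI M Λ ≤ L := by rw [hL', cutConst]; nlinarith
  have hE : decayBase Ct CI M Λ = 1 + 1 / L := by rw [decayBase, ← hL]; ring
  rw [hE]
  set E := 1 + 1 / L with hEdef
  have hL0 : 0 < L := by linarith
  have hE1 : 1 ≤ E := le_add_of_nonneg_right (by positivity)
  have hE0 : 0 < E := by linarith
  have hE2 : E ≤ 5 / 4 := by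
    have : 1 / L ≤ 1 / 4 := one_div_le_one_div_of_le (by norm_num) hL4
    linarith
  refine (min_div_pow_le hx hL4 hxL (m / 4)).trans ?_
  rw [mul_comm (2 : ℝ), mul_assoc]
  refine mul_le_mul_of_nonneg_left ?_ (Real.exp_pos _).le
  -- rounding `m / 4` costs at most the factor `E ^ (3 / 2)`
  have h1 : (E ^ (2 * (m / 4)))⁻¹ ≤ E ^ ((2 : ℝ) + (1 - ((m + 2 : ℕ) : ℝ) / 2)) := by
    rw [← Real.rpow_natCast, ← Real.rpow_neg hE0.le]
    refine Real.rpow_le_rpow_of_exponent_le hE1 ?_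
    have : m ≤ 4 * (m / 4) + 3 := by omega
    have : (m : ℝ) ≤ 4 * ((m / 4 : ℕ) : ℝ) + 3 := by exact_mod_cast this
    push_cast
    linarith
  refine h1.trans ?_
  rw [Real.rpow_add hE0]
  refine mul_le_mul_of_nonneg_right ?_ (Real.rpow_nonneg hE0.le _)
  rw [Real.rpow_two]
  nlinarith

/-- The energy bound of the decomposition is a multiple of `C₂`, with a factor that depends on `d`,
`σ`, `c_P` and a bound `M₀` for `M`. Both the bound for the number of subdomains in a patch and
the bound for the localization error are taken as hypotheses. -/
theorem stableConst_le {d m : ℕ} {Ct CI M Λ Cp cP σ M₀ ν ε c : ℝ} (hCt : 0 < Ct) (hCI : 1 ≤ CI)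
    (hΛ : 1 ≤ Λ) (hCp : 0 < Cp) (hcP : 0 < cP) (hσ : 0 < σ) (hM : 1 ≤ M) (hM₀ : M ≤ M₀)
    (hν0 : 0 ≤ ν) (hν : ν ≤ (((m + 4 : ℕ) + 1) / σ) ^ d) (hε0 : 0 ≤ ε) (hc : 0 ≤ c)
    (hε : ε ≤ c * decayBase Ct CI M Λ ^ (1 - ((m + 2 : ℕ) : ℝ) / 2)) :
    stableConst Ct CI M Λ (cutConst Ct CI M Λ * ν * (ε * (cP * Cp)))
      ≤ (1 + (2 * M₀ + 1) * (1 + (1 / σ) ^ d * c * cP)) * constC2 d (m + 2) Ct CI M Λ Cp := by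
  have hE := decayBase_gt_one (M := M) hCt.le (by linarith : 0 < CI) (by linarith : 0 ≤ Λ)
  rw [constC2, constC0]
  set g := decayBase Ct CI M Λ ^ (1 - ((m + 2 : ℕ) : ℝ) / 2) with hg
  have hg0 : 0 < g := Real.rpow_pos_of_pos (by linarith) _
  set Q : ℝ := (2 * ((m + 2 : ℕ) : ℝ) + 1) ^ d with hQ
  have hQ0 : 0 < Q := by positivity
  set s := (1 / σ) ^ d with hs
  have hs0 : 0 < s := by positivity
  have hνQ : ν ≤ s * Q := by
    refine hν.trans ?_
    rw [hs, hQ, ← mul_pow]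
    refine pow_le_pow_left₀ (by positivity) ?_ d
    rw [div_eq_mul_one_div, mul_comm]
    refine mul_le_mul_of_nonneg_left ?_ (by positivity)
    push_cast
    linarith
  set C0 := 2 * (3 * (Ct + 1) * CI * M ^ 2) * (3 * Ct * M ^ 2 * CI) * Λ ^ 2 * Q * g * (1 + Cp)
    with hC0
  have hC00 : 0 < C0 := by positivity
  have hκ : cutConst Ct CI M Λ ≤ 2 * CI * (Ct + 1) * M ^ 2 * Λ := by
    rw [cutConst]
    have e1 : Ct * M ^ 2 + 1 ≤ (Ct + 1) * M ^ 2 := by nlinarith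
    calc CI * (Ct * M ^ 2 + 1) * (1 + Λ) ≤ CI * ((Ct + 1) * M ^ 2) * (2 * Λ) := by
          gcongr
          linarith
      _ = _ := by ring
  have hκ0 : 0 ≤ cutConst Ct CI M Λ := by rw [cutConst]; positivity
  have hB : cutConst Ct CI M Λ * ν * (ε * (cP * Cp))
      ≤ (2 * CI * (Ct + 1) * M ^ 2 * Λ) * (s * Q) * ((c * g) * (cP * Cp)) := by
    gcongr
  have hS : stableConst Ct CI M Λ (cutConst Ct CI M Λ * ν * (ε * (cP * Cp)))
      ≤ 2 + (CI * Ct * M * (2 * M + 1)) * ((2 * Λ) * (2 * (1 +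
        (2 * CI * (Ct + 1) * M ^ 2 * Λ) * (s * Q) * ((c * g) * (cP * Cp))))) := by
    rw [stableConst]
    have e1 : 2 * (M ^ 2 * Ct) + CI * (Ct * M) ≤ CI * Ct * M * (2 * M + 1) := by
      have : 0 ≤ 2 * (M ^ 2 * Ct) * (CI - 1) := mul_nonneg (by positivity) (by linarith)
      linarith
    gcongr
    linarith
  refine hS.trans ?_
  have t1 : 2 ≤ (6 + 4 * CI * Ct * M) * (Λ + C0) := by
    have : 0 ≤ 4 * CI * Ct * M := by positivity
    nlinarith
  have t2 : 4 * CI * Ct * M * Λ ≤ (6 + 4 * CI * Ct * M) * (Λ + C0) := by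
    have : 0 ≤ 6 * (Λ + C0) + 4 * CI * Ct * M * C0 := by positivity
    linarith
  have t3 : 8 * CI ^ 2 * Ct * (Ct + 1) * M ^ 3 * Λ ^ 2 * Q * g * Cp
      ≤ (6 + 4 * CI * Ct * M) * (Λ + C0) := by
    have e1 : 8 * CI ^ 2 * Ct * (Ct + 1) * M ^ 3 * Λ ^ 2 * Q * g * Cp
        ≤ 18 * CI ^ 2 * Ct * (Ct + 1) * M ^ 4 * Λ ^ 2 * Q * g * (1 + Cp) := by
      gcongr <;> norm_num
    have e2 : 18 * CI ^ 2 * Ct * (Ct + 1) * M ^ 4 * Λ ^ 2 * Q * g * (1 + Cp) = C0 := by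
      rw [hC0]; ring
    have : 0 ≤ 6 * Λ + 5 * C0 + 4 * CI * Ct * M * (Λ + C0) := by positivity
    linarith
  have hM₀0 : 0 ≤ M₀ := by linarith
  set W := (6 + 4 * CI * Ct * M) * (Λ + C0) with hW
  have hW0 : 0 ≤ W := by linarith
  calc _ = 2 + (2 * M + 1) * (4 * CI * Ct * M * Λ) + (2 * M + 1) * (s * c * cP)
        * (8 * CI ^ 2 * Ct * (Ct + 1) * M ^ 3 * Λ ^ 2 * Q * g * Cp) := by ring
    _ ≤ W + (2 * M₀ + 1) * W + (2 * M₀ + 1) * (s * c * cP) * W := by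
        gcongr
    _ = _ := by ring

end TLOS

end

theorem mainTheorem2 (d : ℕ) (hd : 1 ≤ d) (σ cP : ℝ) (hσ : 0 < σ) (hcP : 0 < cP) :
    ∃ K : ℝ, 0 < K ∧
      ∀ (Ω : Set (TLOS.Pt d)) (_hΩ : IsOpen Ω) (_hΩb : Bornology.IsBounded Ω)
        (T : TLOS.Mesh Ω) (N : ℕ) (D : TLOS.Decomposition T N)
        (H : ℝ) (_hH : 0 < H) (_hD : D.IsRegular σ H)
        (P : TLOS.PartitionUnity D) (X : TLOS.Discretization D P)
        (Ih : X.V →ₗ[ℂ] X.Vh) (_hIh : X.IsInterpolation Ih)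
        (Ct CIa CIs Cp Λ : ℝ) (_hCt : 0 < Ct) (_hCIa : 0 < CIa) (_hCIs : 0 < CIs)
        (_hCp : 0 < Cp) (_hΛ : 1 < Λ)
        (e : ∀ i, X.LocalEigenbasis i)
        (_h1 : X.CutoffStable Ct) (_h2 : X.InterpolationStable Ih CIa CIs)
        (_h3 : X.PoincareBound e Λ (cP * Cp))
        (k : ℕ) (_hk : 2 ≤ k),
        1 < TLOS.decayBase Ct (max CIa CIs) D.M Λ ∧
        (∀ z : ℂ, (X.precond e Λ k * X.Ah).HasEigenvalue z → 0 < z.re ∧ z.im = 0) ∧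
        TLOS.condNumber (X.precond e Λ k * X.Ah) ≤
          K * (2 * D.M * TLOS.constC2 d k Ct (max CIa CIs) D.M Λ Cp) := by
  -- `(3 / σ) ^ d` bounds `M`, and `(1 / σ) ^ d (2k+1)^d` the number of subdomains in a patch
  refine ⟨1 + (2 * (3 / σ) ^ d + 1) * (1 + (1 / σ) ^ d * (2 * Real.exp 4) * cP),
    by positivity, ?_⟩
  intro Ω _ _ T N D H hH hD P X Ih hIh Ct CIa CIs Cp Λ hCt hCIa _ hCp hΛ e h1 h2 h3 k hk
  obtain ⟨m, rfl⟩ := Nat.exists_eq_add_of_le' hk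
  have hCI0 : 0 < max CIa CIs := lt_max_of_lt_left hCIa
  have hΛ0 : 0 < Λ := by linarith
  have hE : 1 < TLOS.decayBase Ct (max CIa CIs) D.M Λ :=
    TLOS.decayBase_gt_one hCt.le hCI0 hΛ0.le
  refine ⟨hE, ?_⟩
  rcases subsingleton_or_nontrivial X.Vh with hsub | hnon
  -- in the trivial space there are no eigenvalues, and the condition number is `0 / 0 = 0`
  · have hno : ∀ z : ℂ, ¬ (X.precond e Λ (m + 2) * X.Ah).HasEigenvalue z := fun z hz => by
      obtain ⟨u, hu⟩ := hz.exists_hasEigenvector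
      exact hu.2 (Subsingleton.elim _ _)
    refine ⟨fun z hz => (hno z hz).elim, ?_⟩
    have hg := Real.rpow_pos_of_pos (zero_lt_one.trans hE) (1 - ((m + 2 : ℕ) : ℝ) / 2)
    simp only [TLOS.condNumber, hno, false_and, exists_false, Set.ofPred_false, Real.sSup_empty,
      zero_div]
    rw [TLOS.constC2, TLOS.constC0]
    positivity
  have hCI := TLOS.Discretization.one_le_of_interpolation hIh h2
  -- a nontrivial `V_h` lives on some subdomain
  have hN : Nonempty (Fin N) := by
    by_contra hN
    rw [not_nonempty_iff] at hN
    obtain ⟨u, hu⟩ := exists_ne (0 : X.Vh)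
    have := TLOS.Discretization.sqNorm_a_ι_pos hu
    rw [← TLOS.Discretization.sum_sqNorm_aSub] at this
    simp at this
  obtain ⟨i₀⟩ := hN
  have hM : 1 ≤ D.M := D.one_le_M i₀
  set q : ℝ := (((m + 4 : ℕ) + 1) / σ) ^ d with hq
  have hq0 : 0 ≤ q := by positivity
  have hν : ∀ i, (D.patch i (m + 4)).card ≤ ⌊q⌋₊ := fun i =>
    Nat.le_floor (hD.card_patch_le hσ hH i (m + 4))
  set κ := TLOS.cutConst Ct (max CIa CIs) D.M Λ with hκ
  have hκ0 : 0 < κ := by rw [hκ, TLOS.cutConst]; positivity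
  set S := TLOS.stableConst Ct (max CIa CIs) D.M Λ
    (κ * ⌊q⌋₊ * (min 1 (κ / (1 + 1 / √κ) ^ (m / 4)) * (cP * Cp))) with hS
  have hε0 : 0 ≤ min 1 (κ / (1 + 1 / √κ) ^ (m / 4)) := le_min zero_le_one (by positivity)
  have hS0 : 0 < S := by rw [hS, TLOS.stableConst]; positivity
  have hSle := TLOS.stableConst_le (d := d) (m := m) hCt hCI hΛ.le hCp hcP hσ
    (by exact_mod_cast hM) (hD.M_le hσ hH) (Nat.cast_nonneg ⌊q⌋₊) (Nat.floor_le hq0) hε0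
    (by positivity) (TLOS.min_div_pow_le_decayBase (M := D.M) hCt.le hCI hΛ.le m)
  have hmain := (TLOS.Discretization.precond_isSchwarzOperator e Λ (m + 2)).condNumber_le
    (TLOS.Discretization.a_nonneg.pullback X.ι)
    (fun u hu => TLOS.Discretization.sqNorm_a_ι_pos hu) hM D.overlapSet
    (fun i j h => TLOS.Decomposition.mem_overlapSet_comm.1 h)
    TLOS.Decomposition.card_overlapSet_le
    (fun i j hij u hu v hv => TLOS.Discretization.a_eq_zero_of_disjoint hij hu hv) hS0
    (TLOS.Discretization.exists_stable_decomposition hD hΛ0.le hIh hCt.le hCIa h1 h2 hν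
      (by positivity) h3 hκ)
  refine ⟨hmain.1, hmain.2.trans ?_⟩
  have := mul_le_mul_of_nonneg_left hSle (show (0 : ℝ) ≤ 2 * D.M by positivity)
  refine this.trans (le_of_eq ?_)
  ring
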